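/- Let $U$ be a finite totally ordered set and write $[k]=\{0,\dots,k-1\}$. Let $c\ge 1$, $\ell\ge 1$ and $m$ be integers. Let $\mathcal F$ be any nonempty $2$-universal class of functions $U\to[\ell]$, i.e. $\Pr_{g\in\mathcal F}(g(x)=g(y))\le 2/\ell$ for all distinct $x,y\in U$. Let $\mathcal H$ be any nonempty $2$-wise independent class of functions $U\to[m]$, i.e. $\Pr_{f\in\mathcal H}(f(x)=j\wedge f(y)=k)=1/m^2$ for all distinct $x,y\in U$ and all $j,k\in[m]$. All probabilities refer to uniform choice. The class $\mathcal Z^{c,2}_{\ell,m}$ (built from $\mathcal F$ and $\mathcal H$) consists of all pairs $(h_1,h_2)$ given by data $\langle f_1,f_2,g_1,\dots,g_c,z^{(1)},z^{(2)}\rangle$ with $f_i\in\mathcal H$, $g_j\in\mathcal F$ and arbitrary tables $z^{(i)}\colon\{1,\dots,c\}\times[\ell]\to[m]$, where $$h_i(x)=\Bigl(f_i(x)+\sum_{j=1}^{c}z^{(i)}[j,g_j(x)]\Bigr)\bmod m .$$ It carries the uniform distribution on these data. For $T\subseteq U$, let $\mathrm{bad}_T$ be the event that $|T|-\max_{1\le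 j\le c}|g_j(T)|>1$. Let $\mathcal G^2_{m,n}$ be the set of bipartite multigraphs whose two vertex classes are copies of $[m]$ and whose edges carry distinct labels from $\{1,\dots,n\}$. For $S=\{x_1<\dots<x_n\}\subseteq U$, let $G(S,h_1,h_2)\in\mathcal G^2_{m,n}$ be the graph with, for each $i$, an edge labeled $i$ from $h_1(x_i)$ in the first copy to $h_2(x_i)$ in the second copy. For $G\in\mathcal G^2_{m,n}$ let $T(G)=\{x_i\mid G \text{ has an edge labeled } i\}$. For $\mathsf A\subseteq\mathcal G^2_{m,n}$, let $B^{\mathsf A}_S$ be the event that there is a $G\in\mathsf A$ which is a subgraph of $G(S,h_1,h_2)$ (with coinciding edge labels) and for which $\mathrm{bad}_{T(G)}$ occurs. Let $\mathsf{LL}\subseteq\mathcal G^2_{m,n}$ be the set of graphs without leaf edges (edges incident to a vertex of degree $1$), and let $\mathsf{LC}\subseteq\mathcal G^2_{m,n}$ be the set of graphs in which at most one connected component contains a vertex of degree $1$. **Lemma.** For every $\varepsilon>0$ and every integer $c\ge1$ there is a constant $K>0$, depending only on $\varepsilon$ and $c$, such that the following holds for all $U$, $\ell$, $m$, $\mathcal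 F$, $\mathcal H$ as above and all $S\subseteq U$ with $|S|=n$ and $m\ge(1+\varepsilon)n$: if $(h_1,h_2)$ is chosen at random from $\mathcal Z^{c,2}_{\ell,m}$, then $$\Pr\bigl(B^{\mathsf{LL}}_S\bigr)\le\Pr\bigl(B^{\mathsf{LC}}_S\bigr)\le K\cdot\frac{n}{\ell^{c}} .$$ In particular $\Pr(B^{\mathsf{LL}}_S)\le\Pr(B^{\mathsf{LC}}_S)=O(n/\ell^c)$. -/

import Mathlib

/-- Probability of the event `P` under the uniform distribution on the (nonempty) finite set `A`. -/
noncomputable def unifProb {α : Type*} (A : Finset α) (P : α → Prop) : ℝ :=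
  open Classical in ((A.filter P).card : ℝ) / (A.card : ℝ)

/-! ### Hash classes -/

/-- A `b`-universal hash class with functions from `U` to `[m] = {0, …, m - 1}`. -/
def IsUniversalClass {U : Type*} {m : ℕ} (b : ℝ) (H : Finset (U → Fin m)) : Prop :=
  ∀ x y : U, x ≠ y → unifProb H (fun h => h x = h y) ≤ b / (m : ℝ)

/-- A `κ`-wise independent hash class with functions from `U` to `[m]`. -/
def IsWiseIndependentClass {U : Type*} {m : ℕ} (κ : ℕ) (H : Finset (U → Fin m)) : Prop :=
  ∀ x : Fin κ → U, Function.Injective x → ∀ j : Fin κ → Fin m,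
    unifProb H (fun h => ∀ i, h (x i) = j i) = 1 / (m : ℝ) ^ κ

/-- The data `⟨f₁, …, f_d, g₁, …, g_c, z⁽¹⁾, …, z⁽ᵈ⁾⟩` of a sequence of hash functions. The sequence
is treated as a structure from which its components can be read off. -/
structure HashSeq (U : Type*) (c d ℓ m : ℕ) where
  f : Fin d → U → Fin m
  g : Fin c → U → Fin ℓ
  z : Fin d → Fin c → Fin ℓ → Fin m

namespace HashSeq

/-- `h_i(x) = (f_i(x) + ∑_j z⁽ⁱ⁾[j, g_j(x)]) mod m`. -/
def hash {U : Type*} {c d ℓ m : ℕ} (h : HashSeq U c d ℓ m) (i : Fin d) (x : U) : Fin m :=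
  ⟨((h.f i x : ℕ) + ∑ j : Fin c, (h.z i j (h.g j x) : ℕ)) % m,
    Nat.mod_lt _ (Fin.pos (h.f i x))⟩

/-- A hash sequence is the same thing as the triple of its components. -/
def ofTriple (U : Type*) (c d ℓ m : ℕ) :
    ((Fin d → U → Fin m) × (Fin c → U → Fin ℓ) × (Fin d → Fin c → Fin ℓ → Fin m)) ≃
      HashSeq U c d ℓ m where
  toFun p := ⟨p.1, p.2.1, p.2.2⟩
  invFun h := (h.f, h.g, h.z)
  left_inv _ := rfl
  right_inv _ := rfl

/-- The deficiency `d_T = |T| - max_j |g_j(T)|`. Since `|g_j(T)| ≤ |T|`, the subtraction of natural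
numbers is never truncated. -/
def deficiency {U : Type*} {c d ℓ m : ℕ} (h : HashSeq U c d ℓ m) (T : Finset U) : ℕ :=
  T.card - Finset.univ.sup (fun j : Fin c => (T.image (h.g j)).card)

/-- The event `bad_T`. -/
def Bad {U : Type*} {c d ℓ m : ℕ} (h : HashSeq U c d ℓ m) (T : Finset U) : Prop :=
  1 < h.deficiency T

end HashSeq

/-- The hash class `𝒵^{c,d}_{ℓ,m}(F, H)`: all hash sequences with `f_i ∈ H`, `g_j ∈ F` and arbitrary
tables `z⁽ⁱ⁾`. -/
def hashClassZ {U : Type*} {ℓ m : ℕ} (c d : ℕ) (F : Finset (U → Fin ℓ)) (H : Finset (U → Fin m)) :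
    Finset (HashSeq U c d ℓ m) :=
  ((Fintype.piFinset fun _ : Fin d => H) ×ˢ
    ((Fintype.piFinset fun _ : Fin c => F) ×ˢ Finset.univ)).map
      (HashSeq.ofTriple U c d ℓ m).toEmbedding

/-! ### Labeled bipartite multigraphs -/

/-- The set `𝒢²_{m,n}` of bipartite multigraphs whose two vertex classes are copies of `[m]` and
whose edges carry distinct labels from an `n`-element label set. Such a graph assigns to each label
either no edge or an edge `(a, b)` joining `a` in the first copy with `b` in the second copy. -/
abbrev BiGraph (m n : ℕ) : Type := Fin n → Option (Fin m × Fin m)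

namespace BiGraph

variable {m n : ℕ}

/-- The edge labeled `i` is present in `G` and is incident to the vertex `v`. -/
def Inc (G : BiGraph m n) (i : Fin n) (v : Fin m ⊕ Fin m) : Prop :=
  ∃ e : Fin m × Fin m, G i = some e ∧ (v = Sum.inl e.1 ∨ v = Sum.inr e.2)

/-- The degree of a vertex, counted with multiplicity of edges. -/
noncomputable def degree (G : BiGraph m n) (v : Fin m ⊕ Fin m) : ℕ :=
  {i : Fin n | G.Inc i v}.ncard

/-- The edge labeled `i` is incident to a vertex of degree 1. -/
def IsLeafEdge (G : BiGraph m n) (i : Fin n) : Prop :=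
  ∃ v, G.Inc i v ∧ G.degree v = 1

/-- The simple graph obtained by forgetting labels and multiplicities; it has the same connected
components. -/
def toSimple (G : BiGraph m n) : SimpleGraph (Fin m ⊕ Fin m) where
  Adj u v := u ≠ v ∧ ∃ i, G.Inc i u ∧ G.Inc i v
  symm := ⟨fun _ _ h => ⟨h.1.symm, h.2.imp fun _ hi => ⟨hi.2, hi.1⟩⟩⟩
  loopless := ⟨fun _ h => h.1 rfl⟩

/-- `G'` is a subgraph of `G`, with coinciding edge labels. -/
def IsSub (G' G : BiGraph m n) : Prop :=
  ∀ i e, G' i = some e → G i = some e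

/-- The graph property `LL`: there is no leaf edge. -/
def LL (m n : ℕ) : Set (BiGraph m n) :=
  {G | ∀ i, ¬ G.IsLeafEdge i}

/-- The graph property `LC`: at most one connected component has leaves. (Components that are
isolated vertices have no leaves.) -/
def LC (m n : ℕ) : Set (BiGraph m n) :=
  {G | {C : G.toSimple.ConnectedComponent | ∃ v ∈ C.supp, G.degree v = 1}.Subsingleton}

end BiGraph

/-- The graph `G(S, h₁, h₂)`: the key `x_i` of `S = {x_1 < … < x_n}` contributes the edge
`(h₁(x_i), h₂(x_i))` with label `i`. -/
def keyGraph {U : Type*} [LinearOrder U] {m n : ℕ} (S : Finset U) (hS : S.card = n)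
    (h₁ h₂ : U → Fin m) : BiGraph m n :=
  fun i => some (h₁ (S.orderEmbOfFin hS i), h₂ (S.orderEmbOfFin hS i))

/-- The set `T(G)` of the keys `x_i` of `S` such that `G` contains an edge labeled `i`. -/
def keysOf {U : Type*} [LinearOrder U] {m n : ℕ} (S : Finset U) (hS : S.card = n)
    (G : BiGraph m n) : Finset U :=
  (Finset.univ.filter fun i : Fin n => (G i).isSome).map (S.orderEmbOfFin hS).toEmbedding

/-- The event `B^A_S`: some `G ∈ A` is a subgraph of `G(S, h₁, h₂)` and `bad_{T(G)}` occurs. -/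
def FailureEvent {U : Type*} [LinearOrder U] {c ℓ m n : ℕ} (S : Finset U) (hS : S.card = n)
    (A : Set (BiGraph m n)) (h : HashSeq U c 2 ℓ m) : Prop :=
  ∃ G ∈ A, G.IsSub (keyGraph S hS (h.hash 0) (h.hash 1)) ∧ h.Bad (keysOf S hS G)

/-! The proof is a first-moment bound over small witnesses. An edge set is rooted if all its
vertices except one root have distinct incident edges assigned to them (`IsRootedBy`). Nonempty
graphs in `LC` are rooted (`BiGraph.exists_isRootedBy_of_mem_LC`), and `Bad` forces every `g j` to
collide on their keys. A nonempty rooted set can always lose some edge and stay rooted, so one can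
shrink it until one further deletion would make some `g j` injective; this `g j` then has at most
one collision (`exists_critical_subset`).

Pick a colliding pair for each `j` and follow the assignment from these at most `2c` edges. The
result is at most `2c` trails with `t` edges in total, each edge ending at the root or where some
edge starts (`exists_trailPattern_of_isRootedBy`). Hence the root and the `t` starting points
determine all `2t` endpoints.

If some `g j` has at most one collision, its table together with pairwise independence of `f i`
makes both hash functions uniform on the `t` keys, so a fixed pattern with a fixed root has
probability at most `m^(-t)`. The functions `g j` are independent of each other and of the remaining
data, and all of them collide with probability at most `(2t²/ℓ)^c`. There are at most `n^t` key
sequences, `m` root values and polynomially many patterns, as only the breaks between trails carry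
information. The total is `n/ℓ^c` times a sum of terms `poly(t) (n/m)^(t-1)`, bounded because `m ≥
(1+ε)n`. -/

/-! ### Edge sets with at most one excess vertex -/

section Rooted

variable {V E : Type*}

/-- The vertices incident to an edge of `D`, where `ends e 0` and `ends e 1` are the endpoints of
the edge `e`. -/
def touched (ends : E → Fin 2 → V) (D : Finset E) : Set V :=
  {v | ∃ e ∈ D, ∃ s, ends e s = v}

/-- `φ` assigns distinct incident edges of `D` to the vertices touched by `D`, except `v₀`. -/
def IsRootedBy (ends : E → Fin 2 → V) (D : Finset E) (v₀ : V) (φ : V → E) : Prop :=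
  Set.InjOn φ (touched ends D \ {v₀}) ∧
    ∀ v ∈ touched ends D \ {v₀}, φ v ∈ D ∧ ∃ s, ends (φ v) s = v

lemma touched_mono {ends : E → Fin 2 → V} {D D' : Finset E} (h : D' ⊆ D) :
    touched ends D' ⊆ touched ends D := by
  rintro v ⟨e, he, s, hs⟩
  exact ⟨e, h he, s, hs⟩

/-- A rooted edge set can be shrunk edge by edge to the empty set through rooted edge sets. -/
lemma IsRootedBy.exists_erase [Fintype V] [DecidableEq E] {ends : E → Fin 2 → V} {D : Finset E}
    {v₀ : V} {φ : V → E} (h : IsRootedBy ends D v₀ φ) (hD : D.Nonempty) :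
    ∃ e ∈ D, ∃ v₁, IsRootedBy ends (D.erase e) v₁ φ := by
  classical
  obtain ⟨hinj, hmem⟩ := h
  by_cases h1 : ∃ e ∈ D, ∀ v ∈ touched ends D \ {v₀}, φ v ≠ e
  · obtain ⟨e, he, hne⟩ := h1
    have hsub : touched ends (D.erase e) \ {v₀} ⊆ touched ends D \ {v₀} :=
      Set.sdiff_subset_sdiff_left (touched_mono (Finset.erase_subset _ _))
    exact ⟨e, he, v₀, hinj.mono hsub, fun v hv =>
      ⟨Finset.mem_erase.2 ⟨hne v (hsub hv), (hmem v (hsub hv)).1⟩, (hmem v (hsub hv)).2⟩⟩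
  push Not at h1
  -- If `φ v` is the only edge at `v`, deleting it also makes `v` untouched, so no remaining vertex
  -- needs that edge.
  by_cases h2 : ∃ v ∈ touched ends D \ {v₀}, ∀ e ∈ D, (∃ s, ends e s = v) → e = φ v
  · obtain ⟨v, hv, hleaf⟩ := h2
    refine ⟨φ v, (hmem v hv).1, v₀, ?_⟩
    have hsub : touched ends (D.erase (φ v)) \ {v₀} ⊆ touched ends D \ {v₀} :=
      Set.sdiff_subset_sdiff_left (touched_mono (Finset.erase_subset _ _))
    refine ⟨hinj.mono hsub, fun u hu => ⟨Finset.mem_erase.2 ⟨fun hφ => ?_, (hmem u (hsub hu)).1⟩,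
      (hmem u (hsub hu)).2⟩⟩
    obtain rfl := hinj (hsub hu) hv hφ
    obtain ⟨⟨e, he, hs⟩, -⟩ := hu
    exact (Finset.mem_erase.1 he).1 (hleaf e (Finset.mem_erase.1 he).2 hs)
  push Not at h2
  -- Now `φ` covers `D`, and each non-root touched vertex meets two edges. Counting half-edges gives
  -- `2|D| ≥ 2|A| + deg v₀`, while `|D| ≤ |A|`; so no edge meets the root.
  have hv₀ : v₀ ∉ touched ends D := by
    rintro ⟨e₀, he₀, s₀, hs₀⟩
    let A : Finset V := Finset.univ.filter fun v => v ∈ touched ends D \ {v₀}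
    have hA : ∀ v, v ∈ A ↔ v ∈ touched ends D \ {v₀} := fun v => by simp [A]
    have hDA : D.card ≤ A.card := by
      have : D ⊆ A.image φ := fun e he => by
        obtain ⟨v, hv, rfl⟩ := h1 e he
        exact Finset.mem_image_of_mem _ ((hA v).2 hv)
      exact (Finset.card_le_card this).trans Finset.card_image_le
    have hfib := Finset.card_eq_sum_card_fiberwise (s := D ×ˢ (Finset.univ : Finset (Fin 2)))
      (t := insert v₀ A) (f := fun p => ends p.1 p.2) (by
        rintro ⟨e, s⟩ hp
        have he : e ∈ D := by simpa using hp
        by_cases h : ends e s = v₀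
        · simp [h]
        · exact Finset.mem_coe.2 (Finset.mem_insert_of_mem ((hA _).2 ⟨⟨e, he, s, rfl⟩, h⟩)))
    have hnot : v₀ ∉ A := fun h => ((hA v₀).1 h).2 rfl
    rw [Finset.sum_insert hnot, Finset.card_product, Finset.card_univ, Fintype.card_fin] at hfib
    have hpos : 0 < ((D ×ˢ (Finset.univ : Finset (Fin 2))).filter
        fun p => ends p.1 p.2 = v₀).card :=
      Finset.card_pos.2 ⟨(e₀, s₀), by simp [he₀, hs₀]⟩
    have htwo : ∀ v ∈ A, 2 ≤ ((D ×ˢ (Finset.univ : Finset (Fin 2))).filter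
        fun p => ends p.1 p.2 = v).card := by
      intro v hv
      obtain ⟨e, he, ⟨s, hs⟩, hne⟩ := h2 v ((hA v).1 hv)
      obtain ⟨hφ, s', hs'⟩ := hmem v ((hA v).1 hv)
      have : ({(e, s), (φ v, s')} : Finset (E × Fin 2)).card = 2 :=
        Finset.card_pair fun h => hne (Prod.ext_iff.1 h).1
      refine this.ge.trans (Finset.card_le_card fun p hp => ?_)
      rcases Finset.mem_insert.1 hp with rfl | hp
      · simp [he, hs]
      · rw [Finset.mem_singleton.1 hp]
        simp [hφ, hs']
    have := Finset.sum_le_sum htwo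
    rw [Finset.sum_const, smul_eq_mul] at this
    omega
  -- With the root untouched, every touched vertex has its own edge, so any `v` may give up `φ v`
  -- and become the new root.
  obtain ⟨e, he⟩ := hD
  obtain ⟨v, hv, rfl⟩ := h1 e he
  have hsub : touched ends (D.erase (φ v)) \ {v} ⊆ touched ends D \ {v₀} := fun u hu =>
    have hu' := touched_mono (Finset.erase_subset _ _) hu.1
    ⟨hu', fun h => hv₀ (by rw [← Set.mem_singleton_iff.1 h]; exact hu')⟩
  exact ⟨φ v, he, v, hinj.mono hsub, fun u hu =>
    ⟨Finset.mem_erase.2 ⟨fun hφ => hu.2 (hinj (hsub hu) hv hφ), (hmem u (hsub hu)).1⟩,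
      (hmem u (hsub hu)).2⟩⟩

/-! ### Reduction to a few trails -/

/-- The oriented edge `q = (e, s)`, starting at `ends e s`, continues the oriented edge `p`. -/
def Continues (ends : E → Fin 2 → V) (p q : E × Fin 2) : Prop :=
  ends p.1 (p.2 + 1) = ends q.1 q.2

lemma fin_two_eq_or_eq_add_one (s r : Fin 2) : r = s ∨ r = s + 1 := by
  revert s r; decide

/-- Following `φ` from `u` until a vertex repeats or `A` is reached. -/
lemma IsRootedBy.exists_trail [Fintype V] {ends : E → Fin 2 → V} {D : Finset E}
    {v₀ : V} {φ : V → E} (h : IsRootedBy ends D v₀ φ) (N : ℕ) :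
    ∀ A : Finset V, Fintype.card V - A.card = N → v₀ ∈ A → ∀ u ∈ touched ends D,
      ∃ q : List (E × Fin 2),
        (∀ p ∈ q, p.1 = φ (ends p.1 p.2) ∧ p.1 ∈ D ∧ ends p.1 p.2 ∉ A) ∧
        (q.map fun p => ends p.1 p.2).Nodup ∧
        (∀ p, ends p.1 (p.2 + 1) = u → List.IsChain (Continues ends) (p :: q)) ∧
        (u ∈ A ∨ u ∈ q.map fun p => ends p.1 p.2) ∧
        ∀ p ∈ q, ends p.1 (p.2 + 1) ∈ A ∨ ends p.1 (p.2 + 1) ∈ q.map fun p => ends p.1 p.2 := by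
  classical
  induction N with
  | zero =>
    intro A hA _ u _
    have hu : u ∈ A := by
      rw [(Finset.card_eq_iff_eq_univ A).1 (le_antisymm (Finset.card_le_univ A) (by omega))]
      exact Finset.mem_univ u
    exact ⟨[], by simp, by simp, by simp, Or.inl hu, by simp⟩
  | succ N ih =>
    intro A hA hv₀ u hu
    by_cases huA : u ∈ A
    · exact ⟨[], by simp, by simp, by simp, Or.inl huA, by simp⟩
    have hu' : u ∈ touched ends D \ {v₀} := ⟨hu, fun h => huA (by rwa [Set.mem_singleton_iff.1 h])⟩
    obtain ⟨hφ, s, hs⟩ := h.2 u hu'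
    -- Adding `u` to the stopping set makes the recursion terminate and keeps later starting points
    -- distinct from `u`.
    obtain ⟨q, h1, h2, h3, h4, h5⟩ := ih (insert u A)
      (by rw [Finset.card_insert_of_notMem huA]; omega) (Finset.mem_insert_of_mem hv₀)
      (ends (φ u) (s + 1)) ⟨_, hφ, _, rfl⟩
    refine ⟨(φ u, s) :: q, ?_, ?_, ?_, ?_, ?_⟩
    · intro p hp
      rcases List.mem_cons.1 hp with rfl | hp
      · exact ⟨by simp [hs], hφ, by simpa [hs] using huA⟩
      · exact ⟨(h1 p hp).1, (h1 p hp).2.1, fun h => (h1 p hp).2.2 (Finset.mem_insert_of_mem h)⟩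
    · rw [List.map_cons, List.nodup_cons]
      refine ⟨fun hmem => ?_, h2⟩
      obtain ⟨p, hp, hpe⟩ := List.mem_map.1 hmem
      exact (h1 p hp).2.2 (by rw [hpe]; simp [hs])
    · intro p hp
      exact List.isChain_cons_cons.2 ⟨by simp [Continues, hp, hs], h3 _ rfl⟩
    · right; simp [hs]
    · have key : ∀ w, (w ∈ insert u A ∨ w ∈ q.map fun p => ends p.1 p.2) →
          (w ∈ A ∨ w ∈ ((φ u, s) :: q).map fun p => ends p.1 p.2) := by
        rintro w (hw | hw)
        · rcases Finset.mem_insert.1 hw with rfl | hw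
          · right; simp [hs]
          · exact Or.inl hw
        · exact Or.inr (List.mem_cons_of_mem _ hw)
      intro p hp
      rcases List.mem_cons.1 hp with rfl | hp
      · exact key _ h4
      · exact key _ (h5 p hp)

/-- `L` is a list of distinct oriented edges of `D` which splits into at most `k` trails, and each
edge ends in `v₀` or in the starting point of an edge of `L`. -/
structure IsTrailSystem (ends : E → Fin 2 → V) (D : Finset E) (v₀ : V) (k : ℕ)
    (L : List (E × Fin 2)) : Prop where
  nodup : (L.map Prod.fst).Nodup
  mem : ∀ p ∈ L, p.1 ∈ D
  closed : ∀ p ∈ L, ends p.1 (p.2 + 1) = v₀ ∨ ∃ p' ∈ L, Continues ends p p'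
  breaks : ∃ B : Finset ℕ, B.card ≤ k ∧ ∀ a (ha : a < L.length), a ∉ B →
    ∃ ha' : a + 1 < L.length, Continues ends L[a] L[a + 1]

lemma IsTrailSystem.mono {ends : E → Fin 2 → V} {D : Finset E} {v₀ : V} {k k' : ℕ}
    {L : List (E × Fin 2)} (h : IsTrailSystem ends D v₀ k L) (hk : k ≤ k') :
    IsTrailSystem ends D v₀ k' L :=
  ⟨h.nodup, h.mem, h.closed, h.breaks.imp fun _ hB => ⟨hB.1.trans hk, hB.2⟩⟩

/-- A trail system can be enlarged by one trail to contain a given edge. -/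
lemma IsTrailSystem.exists_extend [Fintype V] {ends : E → Fin 2 → V} {D : Finset E}
    {v₀ : V} {φ : V → E} (h : IsRootedBy ends D v₀ φ) {k : ℕ} {L : List (E × Fin 2)}
    (hL : IsTrailSystem ends D v₀ k L) {e : E} (he : e ∈ D) (heL : e ∉ L.map Prod.fst) :
    ∃ P : List (E × Fin 2), e ∈ P.map Prod.fst ∧ IsTrailSystem ends D v₀ (k + 1) (P ++ L) := by
  classical
  -- Orient `e` so that the trail following `φ` from its far end cannot come straight back along
  -- `e`. Both orientations fail only if `φ` sends two distinct non-root ends to `e`.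
  obtain ⟨s, hs⟩ : ∃ s, ends e (s + 1) = v₀ ∨ ends e s = ends e (s + 1) ∨
      φ (ends e (s + 1)) ≠ e := by
    by_contra! hcon
    obtain ⟨ha, hab, hφa⟩ := hcon 0
    obtain ⟨hb, -, hφb⟩ := hcon 1
    exact hab (h.1 ⟨⟨e, he, _, rfl⟩, hb⟩ ⟨⟨e, he, _, rfl⟩, ha⟩ (hφb.trans hφa.symm))
  -- Since `L` is closed, these are all vertices of `L` together with the root. A trail that starts
  -- its edges outside this set cannot reuse an edge of `L`.
  let VL : Finset V := insert v₀ (L.map fun p => ends p.1 p.2).toFinset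
  have hVL : ∀ p ∈ L, ∀ s', ends p.1 s' ∈ VL := by
    intro p hp s'
    have hstart : ∀ p ∈ L, ends p.1 p.2 ∈ VL := fun p hp =>
      Finset.mem_insert_of_mem (List.mem_toFinset.2 (List.mem_map.2 ⟨p, hp, rfl⟩))
    rcases fin_two_eq_or_eq_add_one p.2 s' with rfl | rfl
    · exact hstart p hp
    · rcases hL.closed p hp with h0 | ⟨p', hp', hc⟩
      · rw [h0]; exact Finset.mem_insert_self _ _
      · rw [show ends p.1 (p.2 + 1) = ends p'.1 p'.2 from hc]; exact hstart p' hp'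
  obtain ⟨q, h1, h2, h3, h4, h5⟩ := h.exists_trail _ (insert (ends e s) VL) rfl
    (by simp [VL]) (ends e (s + 1)) ⟨e, he, _, rfl⟩
  have hqL : ∀ p ∈ q, p.1 ∉ L.map Prod.fst := by
    intro p hp hmem
    obtain ⟨p', hp', hpe⟩ := List.mem_map.1 hmem
    exact (h1 p hp).2.2 (Finset.mem_insert_of_mem (hpe ▸ hVL p' hp' p.2))
  have heq : e ∉ q.map Prod.fst := by
    intro hmem
    obtain ⟨p, hp, rfl⟩ := List.mem_map.1 hmem
    obtain ⟨hp1, hp2, hp3⟩ := h1 p hp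
    have hps : p.2 = s + 1 :=
      (fin_two_eq_or_eq_add_one s p.2).resolve_left fun h => hp3 (by simp [h])
    rw [hps] at hp1 hp3
    rcases hs with hs | hs | hs
    · exact hp3 (by simp [hs, VL])
    · exact hp3 (by simp [hs])
    · exact hs hp1.symm
  refine ⟨(e, s) :: q, by simp, ?_, ?_, ?_, ?_⟩
  · rw [List.map_append, List.nodup_append']
    refine ⟨?_, hL.nodup, ?_⟩
    · rw [List.map_cons, List.nodup_cons]
      refine ⟨heq, ?_⟩
      have hq : q.map Prod.fst = (q.map fun p => ends p.1 p.2).map φ := by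
        rw [List.map_map]
        exact List.map_congr_left fun p hp => (h1 p hp).1
      rw [hq]
      refine List.Nodup.map_on ?_ h2
      intro v hv w hw hvw
      have aux : ∀ v ∈ q.map (fun p => ends p.1 p.2), v ∈ touched ends D \ {v₀} := by
        intro v hv
        obtain ⟨p, hp, rfl⟩ := List.mem_map.1 hv
        exact ⟨⟨_, (h1 p hp).2.1, _, rfl⟩, fun h0 =>
          (h1 p hp).2.2 (by rw [Set.mem_singleton_iff.1 h0]; simp [VL])⟩
      exact h.1 (aux v hv) (aux w hw) hvw
    · intro x hx hxL
      rcases List.mem_cons.1 hx with rfl | hx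
      · exact heL hxL
      · obtain ⟨p, hp, rfl⟩ := List.mem_map.1 hx
        exact hqL p hp hxL
  · intro p hp
    rcases List.mem_append.1 hp with hp | hp
    · rcases List.mem_cons.1 hp with rfl | hp
      · exact he
      · exact (h1 p hp).2.1
    · exact hL.mem p hp
  · have key : ∀ w, (w ∈ insert (ends e s) VL ∨ w ∈ q.map fun p => ends p.1 p.2) →
        w = v₀ ∨ ∃ p' ∈ (e, s) :: q ++ L, w = ends p'.1 p'.2 := by
      rintro w (hw | hw)
      · rcases Finset.mem_insert.1 hw with rfl | hw
        · exact Or.inr ⟨(e, s), by simp, rfl⟩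
        · rcases Finset.mem_insert.1 hw with rfl | hw
          · exact Or.inl rfl
          · obtain ⟨p, hp, rfl⟩ := List.mem_map.1 (List.mem_toFinset.1 hw)
            exact Or.inr ⟨p, List.mem_append_right _ hp, rfl⟩
      · obtain ⟨p, hp, rfl⟩ := List.mem_map.1 hw
        exact Or.inr ⟨p, List.mem_append_left _ (List.mem_cons_of_mem _ hp), rfl⟩
    intro p hp
    rcases List.mem_append.1 hp with hp | hp
    · rcases List.mem_cons.1 hp with rfl | hp
      · exact key _ h4
      · exact key _ (h5 p hp)
    · exact (hL.closed p hp).imp_right fun ⟨p', hp', hc⟩ => ⟨p', List.mem_append_right _ hp', hc⟩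
  · obtain ⟨B, hB, hBc⟩ := hL.breaks
    have hchain := h3 (e, s) rfl
    generalize (e, s) :: q = P at hchain
    -- The only new break is at the last edge of `P`; the old breaks are shifted by the length of
    -- `P`.
    refine ⟨insert (P.length - 1) (B.image (· + P.length)), ?_, ?_⟩
    · exact (Finset.card_insert_le _ _).trans (Nat.succ_le_succ (Finset.card_image_le.trans hB))
    · intro a ha haB
      rw [List.length_append] at ha
      have ha1 : a ≠ P.length - 1 := fun h => haB (by simp [h])
      have ha2 : ∀ b ∈ B, b + P.length ≠ a := fun b hb h =>
        haB (Finset.mem_insert_of_mem (Finset.mem_image.2 ⟨b, hb, h⟩))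
      by_cases haP : a < P.length
      · have haP' : a + 1 < P.length := by omega
        refine ⟨by rw [List.length_append]; omega, ?_⟩
        rw [List.getElem_append_left haP, List.getElem_append_left haP']
        exact List.isChain_iff_getElem.1 hchain a haP'
      · obtain ⟨h', hc⟩ := hBc (a - P.length) (by omega) fun h => ha2 _ h (by omega)
        refine ⟨by rw [List.length_append]; omega, ?_⟩
        rw [List.getElem_append_right (by omega), List.getElem_append_right (by omega)]
        convert hc using 2
        omega

/-- Edges of `W` are inserted one by one: an edge already covered costs nothing, any other costs one
trail. -/
lemma IsRootedBy.exists_isTrailSystem [Fintype V] [DecidableEq E] {ends : E → Fin 2 → V}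
    {D : Finset E} {v₀ : V} {φ : V → E} (h : IsRootedBy ends D v₀ φ) (W : Finset E) :
    W ⊆ D → ∃ L, IsTrailSystem ends D v₀ W.card L ∧ ∀ e ∈ W, e ∈ L.map Prod.fst := by
  induction W using Finset.induction_on with
  | empty => exact fun _ => ⟨[], ⟨by simp, by simp, by simp, ∅, by simp⟩, by simp⟩
  | insert e W heW ih =>
    intro hW
    obtain ⟨L, hL, hWL⟩ := ih fun x hx => hW (Finset.mem_insert_of_mem hx)
    rw [Finset.card_insert_of_notMem heW]
    by_cases heL : e ∈ L.map Prod.fst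
    · refine ⟨L, hL.mono (Nat.le_succ _), fun x hx => ?_⟩
      rcases Finset.mem_insert.1 hx with rfl | hx
      exacts [heL, hWL x hx]
    · obtain ⟨P, heP, hP⟩ := hL.exists_extend h (hW (Finset.mem_insert_self e W)) heL
      refine ⟨P ++ L, hP, fun x hx => ?_⟩
      rw [List.map_append]
      rcases Finset.mem_insert.1 hx with rfl | hx
      exacts [List.mem_append_left _ heP, List.mem_append_right _ (hWL x hx)]

/-! ### Patterns -/

/-- The incidence pattern of at most `k` concatenated trails with `t` edges: the `a`-th edge starts
on side `σ a` and ends at the start of the edge number `r a`, or at a fixed vertex. -/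
def IsTrailPattern (t k : ℕ) (p : (Fin t → Fin 2) × (Fin t → Option (Fin t))) : Prop :=
  ∃ B : Finset (Fin t), B.card ≤ k ∧ ∀ a ∉ B, ∃ h : (a : ℕ) + 1 < t,
    p.2 a = some ⟨a + 1, h⟩ ∧ p.1 ⟨a + 1, h⟩ = p.1 a + 1

lemma IsTrailSystem.exists_pattern {ends : E → Fin 2 → V}
    (hside : ∀ e e' s s', ends e s = ends e' s' → s = s')
    {D : Finset E} {v₀ : V} {k : ℕ} {L : List (E × Fin 2)} (hL : IsTrailSystem ends D v₀ k L) :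
    ∃ r : Fin L.length → Option (Fin L.length),
      IsTrailPattern L.length k (fun a => (L.get a).2, r) ∧
      ∀ a, ends (L.get a).1 ((L.get a).2 + 1) =
        (r a).elim v₀ fun b => ends (L.get b).1 (L.get b).2 := by
  classical
  obtain ⟨B, hB, hBc⟩ := hL.breaks
  have : ∀ a : Fin L.length, ∃ o : Option (Fin L.length),
      ends (L.get a).1 ((L.get a).2 + 1) =
        o.elim v₀ (fun b => ends (L.get b).1 (L.get b).2) ∧
      ((a : ℕ) ∉ B → ∃ h : (a : ℕ) + 1 < L.length, o = some ⟨a + 1, h⟩) := by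
    intro a
    by_cases ha : (a : ℕ) ∈ B
    · rcases hL.closed (L.get a) (L.get_mem a) with h0 | ⟨p, hp, hc⟩
      · exact ⟨none, h0, fun h => absurd ha h⟩
      · obtain ⟨b, rfl⟩ := List.get_of_mem hp
        exact ⟨some b, hc, fun h => absurd ha h⟩
    · obtain ⟨h, hc⟩ := hBc a a.2 ha
      exact ⟨some ⟨a + 1, h⟩, hc, fun _ => ⟨h, rfl⟩⟩
  choose r hr hrB using this
  refine ⟨r, ⟨Finset.univ.filter fun a : Fin L.length => (a : ℕ) ∈ B, ?_, ?_⟩, hr⟩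
  · refine le_trans ?_ hB
    refine Finset.card_le_card_of_injOn (fun a => (a : ℕ)) (fun a ha => ?_)
      (Fin.val_injective.injOn)
    simpa using ha
  · intro a ha
    obtain ⟨h, hra⟩ := hrB a (by simpa using ha)
    refine ⟨h, hra, ?_⟩
    have := hr a
    rw [hra] at this
    exact (hside _ _ _ _ this).symm

end Rooted

/-- There are only polynomially many trail patterns with a bounded number of trails. -/
lemma card_isTrailPattern_le {t : ℕ} (ht : 0 < t) (k : ℕ) [DecidablePred (IsTrailPattern t k)] :
    (Finset.univ.filter (IsTrailPattern t k)).card ≤ 2 * (t * ((t + 1) * 2)) ^ k := by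
  classical
  let next : Fin t → Fin t := fun a => if h : (a : ℕ) + 1 < t then ⟨a + 1, h⟩ else a
  have hex : ∀ p : (Fin t → Fin 2) × (Fin t → Option (Fin t)), ∃ κ : Fin k → Fin t,
      IsTrailPattern t k p → ∀ a ∉ Set.range κ, ∃ h : (a : ℕ) + 1 < t,
        p.2 a = some ⟨a + 1, h⟩ ∧ p.1 ⟨a + 1, h⟩ = p.1 a + 1 := by
    intro p
    by_cases hp : IsTrailPattern t k p
    · obtain ⟨B, hB, hreg⟩ := hp
      -- The last index has no successor, so it is a break. Thus `B` is nonempty and `Fin k` can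
      -- enumerate it with repetitions.
      have hlast : (⟨t - 1, by omega⟩ : Fin t) ∈ B := by
        by_contra h
        obtain ⟨h', -⟩ := hreg _ h
        simp only at h'
        omega
      have : Nonempty B := ⟨⟨_, hlast⟩⟩
      obtain ⟨f⟩ := Function.Embedding.nonempty_of_card_le (α := B) (β := Fin k) (by simpa using hB)
      refine ⟨fun i => (Function.invFun f i : B), fun _ a ha => hreg a fun haB => ha ?_⟩
      obtain ⟨i, hi⟩ := Function.invFun_surjective f.injective ⟨a, haB⟩
      exact ⟨i, by simp [hi]⟩
    · exact ⟨fun _ => ⟨0, ht⟩, fun h => absurd h hp⟩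
  choose κ hκ using hex
  -- Away from breaks, targets are forced and sides alternate. It suffices to record the first side
  -- and, per break, its position, its target and the side of the next edge.
  let code : (Fin t → Fin 2) × (Fin t → Option (Fin t)) →
      Fin 2 × (Fin k → Fin t × Option (Fin t) × Fin 2) :=
    fun p => (p.1 ⟨0, ht⟩, fun i => (κ p i, p.2 (κ p i), p.1 (next (κ p i))))
  have hinj : Set.InjOn code (Finset.univ.filter (IsTrailPattern t k)) := by
    intro p hp p' hp' hcode
    have hp : IsTrailPattern t k p := by simpa using hp
    have hp' : IsTrailPattern t k p' := by simpa using hp'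
    obtain ⟨h0, hrest⟩ := Prod.ext_iff.1 hcode
    have hκe : κ p = κ p' := funext fun i => congrArg Prod.fst (congrFun hrest i)
    have hr : ∀ i, p.2 (κ p i) = p'.2 (κ p i) := fun i => by
      have := congrArg (fun x => x.2.1) (congrFun hrest i)
      simpa only [code, hκe] using this
    have hσ : ∀ i, p.1 (next (κ p i)) = p'.1 (next (κ p i)) := fun i => by
      have := congrArg (fun x => x.2.2) (congrFun hrest i)
      simpa only [code, hκe] using this
    refine Prod.ext (funext fun a => ?_) (funext fun a => ?_)
    · obtain ⟨a, ha⟩ := a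
      induction a with
      | zero => exact h0
      | succ a ih =>
        have ha' : a < t := by omega
        by_cases hmem : (⟨a, ha'⟩ : Fin t) ∈ Set.range (κ p)
        · obtain ⟨i, hi⟩ := hmem
          have := hσ i
          rw [hi] at this
          simpa [next, ha] using this
        · obtain ⟨_, _, h1⟩ := hκ p hp _ hmem
          obtain ⟨_, _, h2⟩ := hκ p' hp' _ (hκe ▸ hmem)
          exact h1.trans ((congrArg (· + 1) (ih ha')).trans h2.symm)
    · by_cases hmem : a ∈ Set.range (κ p)
      · obtain ⟨i, rfl⟩ := hmem
        exact hr i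
      · obtain ⟨_, h1, _⟩ := hκ p hp _ hmem
        obtain ⟨_, h2, _⟩ := hκ p' hp' _ (hκe ▸ hmem)
        exact h1.trans h2.symm
  refine (Finset.card_le_card_of_injOn code (fun _ _ => Finset.mem_coe.2 (Finset.mem_univ _))
    hinj).trans (le_of_eq ?_)
  simp

/-! ### Graphs with at most one leaf component are rooted -/

namespace BiGraph

variable {m n : ℕ}

lemma LL_subset_LC : LL m n ⊆ LC m n := by
  rintro G hG C ⟨v, -, hv⟩
  obtain ⟨i, hi⟩ := Set.nonempty_of_ncard_ne_zero (s := {i : Fin n | G.Inc i v})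
    (ne_of_eq_of_ne hv one_ne_zero)
  exact absurd ⟨v, hi, hv⟩ (hG i)

/-- In the root's component each vertex takes the first edge of a shortest path to the root.
Elsewhere there are no leaves: touched vertices have degree at least 2 and edges have at most two
ends, so Hall's condition holds. -/
lemma exists_isRootedBy_of_mem_LC {G : BiGraph m n} (hG : G ∈ LC m n)
    {ends : Fin n → Fin 2 → Fin m ⊕ Fin m} {D : Finset (Fin n)} (hD : D.Nonempty)
    (hInc : ∀ i v, G.Inc i v ↔ i ∈ D ∧ ∃ s, ends i s = v) :
    ∃ v₀ φ, IsRootedBy ends D v₀ φ := by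
  classical
  obtain ⟨i₀, hi₀⟩ := hD
  obtain ⟨v₀, hv₀⟩ : ∃ v₀, ∀ v, G.degree v = 1 → G.toSimple.Reachable v v₀ := by
    by_cases h : ∃ v₀, G.degree v₀ = 1
    · obtain ⟨v₀, h₀⟩ := h
      exact ⟨v₀, fun v hv => SimpleGraph.ConnectedComponent.exact
        (hG ⟨v, rfl, hv⟩ ⟨v₀, rfl, h₀⟩)⟩
    · exact ⟨ends i₀ 0, fun v hv => absurd ⟨v, hv⟩ h⟩
  let inc : Fin m ⊕ Fin m → Finset (Fin n) := fun v => D.filter fun i => ∃ s, ends i s = v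
  have hinc : ∀ i v, i ∈ inc v ↔ i ∈ D ∧ ∃ s, ends i s = v := fun i v => Finset.mem_filter
  have hdeg : ∀ v, G.degree v = (inc v).card := fun v => by
    rw [degree, ← Set.ncard_coe_finset]
    congr 1
    ext i
    rw [Finset.mem_coe, hinc]
    exact hInc i v
  have hother : ∀ i s s', ends i s ≠ ends i s' → s' = s + 1 := fun i s s' hne =>
    (fin_two_eq_or_eq_add_one s s').resolve_left fun h => hne (by rw [h])
  -- parent edges in the component of the root
  have hparent : ∀ v, ∃ i, v ≠ v₀ → G.toSimple.Reachable v v₀ →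
      ∃ s, i ∈ D ∧ ends i s = v ∧ ends i (s + 1) ≠ v ∧
        G.toSimple.dist (ends i (s + 1)) v₀ < G.toSimple.dist v v₀ := by
    intro v
    by_cases hv : v ≠ v₀ ∧ G.toSimple.Reachable v v₀
    · obtain ⟨p, hp⟩ := hv.2.exists_walk_length_eq_dist
      cases p with
      | nil => exact absurd rfl hv.1
      | @cons _ w _ hadj p =>
        rw [SimpleGraph.Walk.length_cons] at hp
        obtain ⟨hne, i, hiv, hiw⟩ := hadj
        obtain ⟨hiD, s, hs⟩ := (hInc _ _).1 hiv
        obtain ⟨-, s', hs'⟩ := (hInc _ _).1 hiw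
        obtain rfl := hother i s s' (by rw [hs, hs']; exact hne)
        refine ⟨i, fun _ _ => ⟨s, hiD, hs, by rw [hs']; exact hne.symm, ?_⟩⟩
        rw [hs', ← hp]
        exact Nat.lt_succ_of_le (SimpleGraph.dist_le p)
    · exact ⟨i₀, fun h h' => absurd ⟨h, h'⟩ hv⟩
  choose par hpar using hparent
  -- a system of distinct representatives in the other components
  let Far := {v : Fin m ⊕ Fin m // v ∈ touched ends D ∧ ¬ G.toSimple.Reachable v v₀}
  obtain ⟨ψ, hψinj, hψ⟩ := (Finset.all_card_le_biUnion_card_iff_exists_injective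
      (fun v : Far => inc v.1)).1 (by
    intro X
    have := Finset.card_mul_le_card_mul (s := X) (t := X.biUnion fun v => inc v.1)
      (fun v i => i ∈ inc v.1) (m := 2) (n := 2) (by
        intro v hv
        have hsub : inc v.1 ⊆ Finset.bipartiteAbove (fun (v : Far) i => i ∈ inc v.1)
            (X.biUnion fun v => inc v.1) v := fun i hi =>
          Finset.mem_filter.2 ⟨Finset.mem_biUnion.2 ⟨v, hv, hi⟩, hi⟩
        refine le_trans ?_ (Finset.card_le_card hsub)
        have h1 : (inc v.1).card ≠ 1 := fun h => v.2.2 (hv₀ _ ((hdeg _).trans h))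
        have h0 : 0 < (inc v.1).card := by
          obtain ⟨i, hi, hs⟩ := v.2.1
          exact Finset.card_pos.2 ⟨i, (hinc _ _).2 ⟨hi, hs⟩⟩
        omega) (by
        intro i _
        have hsub : (Finset.bipartiteBelow (fun (v : Far) i => i ∈ inc v.1) X i).image
            (fun v => v.1) ⊆ Finset.univ.image (ends i) := by
          intro v hv
          obtain ⟨v, hvi, rfl⟩ := Finset.mem_image.1 hv
          obtain ⟨-, s, hs⟩ := (hinc _ _).1 (Finset.mem_filter.1 hvi).2
          exact Finset.mem_image.2 ⟨s, Finset.mem_univ _, hs⟩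
        have := (Finset.card_le_card hsub).trans Finset.card_image_le
        rwa [Finset.card_image_of_injective _ Subtype.val_injective, Finset.card_univ,
          Fintype.card_fin] at this)
    omega)
  have hreach : ∀ i ∈ D, ∀ s s', G.toSimple.Reachable (ends i s) (ends i s') := by
    intro i hi s s'
    by_cases h : ends i s = ends i s'
    · rw [h]
    · exact SimpleGraph.Adj.reachable
        ⟨h, i, (hInc _ _).2 ⟨hi, _, rfl⟩, (hInc _ _).2 ⟨hi, _, rfl⟩⟩
  let φ : Fin m ⊕ Fin m → Fin n := fun v =>
    if h : v ∈ touched ends D ∧ ¬ G.toSimple.Reachable v v₀ then ψ ⟨v, h⟩ else par v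
  have hfar : ∀ v (h : v ∈ touched ends D ∧ ¬ G.toSimple.Reachable v v₀), φ v = ψ ⟨v, h⟩ :=
    fun v h => dif_pos h
  have hnear : ∀ v, G.toSimple.Reachable v v₀ → φ v = par v :=
    fun v h => dif_neg fun h' => h'.2 h
  have hmem : ∀ v ∈ touched ends D \ {v₀}, φ v ∈ D ∧ ∃ s, ends (φ v) s = v := by
    intro v hv
    by_cases hr : G.toSimple.Reachable v v₀
    · rw [hnear v hr]
      obtain ⟨s, h1, h2, -⟩ := hpar v hv.2 hr
      exact ⟨h1, s, h2⟩
    · rw [hfar v ⟨hv.1, hr⟩]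
      exact (hinc _ _).1 (hψ ⟨v, hv.1, hr⟩)
  refine ⟨v₀, φ, ?_, hmem⟩
  intro v hv w hw hvw
  have hrr : G.toSimple.Reachable v w := by
    obtain ⟨hD, s, hs⟩ := hmem v hv
    obtain ⟨-, s', hs'⟩ := hmem w hw
    have := hreach _ hD s s'
    rwa [hs, hvw, hs'] at this
  by_cases hr : G.toSimple.Reachable v v₀
  · have hr' := hrr.symm.trans hr
    rw [hnear v hr, hnear w hr'] at hvw
    obtain ⟨s, h1, h2, h3, h4⟩ := hpar v hv.2 hr
    obtain ⟨s', h1', h2', h3', h4'⟩ := hpar w hw.2 hr'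
    rw [← hvw] at h2' h3' h4'
    -- Opposite ends of a shared parent edge would each have to be strictly closer to the root than
    -- the other.
    rcases fin_two_eq_or_eq_add_one s s' with rfl | rfl
    · exact h2.symm.trans h2'
    · have hss : s + 1 + 1 = s := by fin_cases s <;> rfl
      rw [h2'] at h4
      rw [hss, h2] at h4'
      omega
  · have hr' : ¬ G.toSimple.Reachable w v₀ := fun h => hr (hrr.trans h)
    rw [hfar v ⟨hv.1, hr⟩, hfar w ⟨hw.1, hr'⟩] at hvw
    exact congrArg Subtype.val (hψinj hvw)

end BiGraph

/-! ### Critical edge sets and their reduction to bounded trail patterns. -/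

lemma IsTrailPattern.mono {t k k' : ℕ} {p : (Fin t → Fin 2) × (Fin t → Option (Fin t))}
    (h : IsTrailPattern t k p) (hk : k ≤ k') : IsTrailPattern t k' p :=
  h.imp fun _ hB => ⟨hB.1.trans hk, hB.2⟩

/-- Each element of `D \ T` contributes at most one image point, so passing to a subset cannot
increase the deficiency. -/
lemma card_le_card_image_add_one_of_subset {α β : Type*} [DecidableEq α] [DecidableEq β]
    {f : α → β} {T D : Finset α} (hTD : T ⊆ D) (hD : D.card ≤ (D.image f).card + 1) :
    T.card ≤ (T.image f).card + 1 := by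
  have h1 : (D.image f).card ≤ (T.image f).card + (D \ T).card := by
    rw [← Finset.union_sdiff_of_subset hTD, Finset.image_union, Finset.union_sdiff_of_subset hTD]
    exact (Finset.card_union_le _ _).trans (Nat.add_le_add_left Finset.card_image_le _)
  have h2 := Finset.card_sdiff_add_card_eq_card hTD
  omega

/-- A rooted edge set on which all colorings collide contains one on which, in addition, some
coloring has at most one collision. -/
lemma exists_critical_subset {V E C : Type*} [Fintype V] [DecidableEq E] [DecidableEq C] {c : ℕ}
    (hc : 1 ≤ c) (ends : E → Fin 2 → V) (γ : Fin c → E → C) (D : Finset E) :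
    (∃ v₀ φ, IsRootedBy ends D v₀ φ) → (∀ j, ¬ Set.InjOn (γ j) D) →
      ∃ D' : Finset E, (∃ v₀ φ, IsRootedBy ends D' v₀ φ) ∧
        (∀ j, ¬ Set.InjOn (γ j) D') ∧ ∃ j, D'.card ≤ (D'.image (γ j)).card + 1 := by
  induction D using Finset.strongInduction with
  | H D ih =>
    intro hroot hcol
    have hD : D.Nonempty := by
      rw [Finset.nonempty_iff_ne_empty]
      rintro rfl
      exact hcol ⟨0, hc⟩ (by simp)
    obtain ⟨v₀, φ, h⟩ := hroot
    obtain ⟨e, he, v₁, h₁⟩ := h.exists_erase hD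
    by_cases hcol' : ∀ j, ¬ Set.InjOn (γ j) (D.erase e : Finset E)
    · exact ih _ (Finset.erase_ssubset he) ⟨v₁, φ, h₁⟩ hcol'
    · push Not at hcol'
      obtain ⟨j, hj⟩ := hcol'
      refine ⟨D, ⟨v₀, φ, h⟩, hcol, j, ?_⟩
      have h2 := Finset.card_le_card (Finset.image_subset_image (f := γ j) (Finset.erase_subset e D))
      rw [Finset.card_image_of_injOn hj, Finset.card_erase_of_mem he] at h2
      omega

/-- Reduction of a rooted edge set with collisions to a bounded number of trails. -/
lemma exists_trailPattern_of_isRootedBy {V E C : Type*} [Fintype V] [DecidableEq E]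
    [DecidableEq C] {c : ℕ} (hc : 1 ≤ c) {ends : E → Fin 2 → V}
    (hside : ∀ e e' s s', ends e s = ends e' s' → s = s') {γ : Fin c → E → C} {D : Finset E}
    (hroot : ∃ v₀ φ, IsRootedBy ends D v₀ φ) (hcol : ∀ j, ¬ Set.InjOn (γ j) D) :
    ∃ (v₀ : V) (t : ℕ) (x : Fin t → E) (p : (Fin t → Fin 2) × (Fin t → Option (Fin t))),
      Function.Injective x ∧ IsTrailPattern t (2 * c) p ∧
      (∀ j, ¬ Function.Injective (γ j ∘ x)) ∧
      (∃ j, t ≤ (Finset.univ.image (γ j ∘ x)).card + 1) ∧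
      ∀ a, ends (x a) (p.1 a + 1) = (p.2 a).elim v₀ fun b => ends (x b) (p.1 b) := by
  obtain ⟨D, ⟨v₀, φ, hφ⟩, hcol, j₀, hj₀⟩ := exists_critical_subset hc ends γ D hroot hcol
  have hpair : ∀ j, ∃ a ∈ D, ∃ b ∈ D, γ j a = γ j b ∧ a ≠ b := fun j => by
    have := hcol j
    simp only [Set.InjOn] at this
    push Not at this
    obtain ⟨a, ha, b, hb, h⟩ := this
    exact ⟨a, ha, b, hb, h⟩
  choose a ha b hb hab hne using hpair
  -- Keeping one colliding pair per `j` preserves all collisions; this is where the bound of `2c`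
  -- trails comes from.
  let W : Finset E := Finset.univ.biUnion fun j => {a j, b j}
  have hWD : W ⊆ D := by
    intro e he
    obtain ⟨j, -, hj⟩ := Finset.mem_biUnion.1 he
    rcases Finset.mem_insert.1 hj with rfl | hj
    · exact ha j
    · rw [Finset.mem_singleton.1 hj]; exact hb j
  have hWc : W.card ≤ 2 * c := by
    have := Finset.card_biUnion_le_card_mul Finset.univ (fun j => ({a j, b j} : Finset E)) 2
      fun j _ => Finset.card_le_two
    rw [Finset.card_univ, Fintype.card_fin] at this
    exact this.trans (mul_comm c 2).le
  obtain ⟨L, hL, hWL⟩ := hφ.exists_isTrailSystem W hWD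
  obtain ⟨r, hr, hends⟩ := hL.exists_pattern hside
  have hx : Function.Injective fun i => (L.get i).1 := by
    have := List.nodup_iff_injective_get.1 hL.nodup
    intro i i' h
    have h' := @this ⟨i, by simp⟩ ⟨i', by simp⟩ (by simpa using h)
    exact Fin.ext (by simpa using h')
  refine ⟨v₀, L.length, fun i => (L.get i).1, _, hx, hr.mono hWc, ?_, ⟨j₀, ?_⟩, hends⟩
  · intro j hinj
    have hmem : ∀ e ∈ W, ∃ i, (L.get i).1 = e := fun e he => by
      obtain ⟨p, hp, rfl⟩ := List.mem_map.1 (hWL e he)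
      obtain ⟨i, rfl⟩ := List.get_of_mem hp
      exact ⟨i, rfl⟩
    obtain ⟨i, hi⟩ := hmem (a j) (Finset.mem_biUnion.2 ⟨j, Finset.mem_univ _, by simp⟩)
    obtain ⟨i', hi'⟩ := hmem (b j) (Finset.mem_biUnion.2 ⟨j, Finset.mem_univ _, by simp⟩)
    refine hne j ?_
    rw [← hi, ← hi']
    exact congrArg (fun i => (L.get i).1) (hinj (by simpa only [Function.comp, hi, hi'] using hab j))
  · have hsub : Finset.univ.image (fun i => (L.get i).1) ⊆ D := by
      intro e he
      obtain ⟨i, -, rfl⟩ := Finset.mem_image.1 he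
      exact hL.mem _ (L.get_mem i)
    have := card_le_card_image_add_one_of_subset hsub hj₀
    rwa [Finset.card_image_of_injective _ hx, Finset.card_univ, Fintype.card_fin,
      Finset.image_image] at this

/-! ### The structure of failure events -/

/-- The keys `y a` form a critical trail system of the given incidence pattern. -/
def CriticalTrail {U : Type*} {c ℓ m t : ℕ} (y : Fin t → U)
    (p : (Fin t → Fin 2) × (Fin t → Option (Fin t))) (w : Fin m) (h : HashSeq U c 2 ℓ m) : Prop :=
  (∀ j, ¬ Function.Injective (h.g j ∘ y)) ∧
  (∃ j, t ≤ (Finset.univ.image (h.g j ∘ y)).card + 1) ∧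
  ∀ a, h.hash (p.1 a + 1) (y a) = (p.2 a).elim w fun b => h.hash (p.1 b) (y b)

/-- A single injective `g j` already gives deficiency zero. -/
lemma not_injOn_of_bad {U : Type*} {c d ℓ m : ℕ} {h : HashSeq U c d ℓ m} {T : Finset U}
    (hbad : h.Bad T) (j : Fin c) : ¬ Set.InjOn (h.g j) T := by
  intro hinj
  have h1 := Finset.card_image_of_injOn hinj
  have h2 := Finset.le_sup (f := fun j : Fin c => (T.image (h.g j)).card) (Finset.mem_univ j)
  rw [HashSeq.Bad, HashSeq.deficiency] at hbad
  omega

lemma exists_criticalTrail_of_failureEvent {U : Type*} [LinearOrder U] {c ℓ m n : ℕ} (hc : 1 ≤ c)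
    {S : Finset U} {hS : S.card = n} {h : HashSeq U c 2 ℓ m}
    (hfail : FailureEvent S hS (BiGraph.LC m n) h) :
    ∃ (t : ℕ) (x : Fin t → Fin n) (p : (Fin t → Fin 2) × (Fin t → Option (Fin t))) (w : Fin m),
      Function.Injective x ∧ IsTrailPattern t (2 * c) p ∧
        CriticalTrail (S.orderEmbOfFin hS ∘ x) p w h := by
  classical
  obtain ⟨G, hG, hsub, hbad⟩ := hfail
  let D : Finset (Fin n) := Finset.univ.filter fun i => (G i).isSome
  let vert : Fin 2 → Fin m → Fin m ⊕ Fin m := fun s a => if s = 0 then Sum.inl a else Sum.inr a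
  have hval : ∀ s a, Sum.elim id id (vert s a) = a := fun s a => by
    by_cases hs : s = 0 <;> simp [vert, hs]
  let ends : Fin n → Fin 2 → Fin m ⊕ Fin m := fun i s => vert s (h.hash s (S.orderEmbOfFin hS i))
  have hside : ∀ e e' s s', ends e s = ends e' s' → s = s' := by
    intro e e' s s' hs
    fin_cases s <;> fin_cases s' <;> simp [ends, vert] at hs ⊢
  have hInc : ∀ i v, G.Inc i v ↔ i ∈ D ∧ ∃ s, ends i s = v := by
    intro i v
    have hi : ∀ e, G i = some e → e = (h.hash 0 (S.orderEmbOfFin hS i),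
        h.hash 1 (S.orderEmbOfFin hS i)) := fun e he =>
      (Option.some_injective _ (hsub i e he)).symm
    constructor
    · rintro ⟨e, he, hv⟩
      refine ⟨by simp [D, he], ?_⟩
      rw [hi e he] at hv
      rcases hv with rfl | rfl
      · exact ⟨0, by simp [ends, vert]⟩
      · exact ⟨1, by simp [ends, vert]⟩
    · rintro ⟨hiD, s, rfl⟩
      obtain ⟨e, he⟩ := Option.isSome_iff_exists.1 (Finset.mem_filter.1 hiD).2
      refine ⟨e, he, ?_⟩
      rw [hi e he]
      fin_cases s
      · left; simp [ends, vert]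
      · right; simp [ends, vert]
  have hcol : ∀ j, ¬ Set.InjOn (h.g j ∘ S.orderEmbOfFin hS) D := by
    intro j hinj
    refine not_injOn_of_bad hbad j ?_
    have hkeys : ((keysOf S hS G : Finset U) : Set U) = S.orderEmbOfFin hS '' D := by
      rw [keysOf, Finset.coe_map]; rfl
    rw [hkeys]
    exact hinj.image_of_comp
  have hD : D.Nonempty := by
    rw [Finset.nonempty_iff_ne_empty]
    intro hD
    exact hcol ⟨0, hc⟩ (by simp [hD])
  obtain ⟨v₀, t, x, p, h1, h2, h3, h4, h5⟩ := exists_trailPattern_of_isRootedBy hc hside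
    (BiGraph.exists_isRootedBy_of_mem_LC hG hD hInc) hcol
  -- The side of the root can be forgotten: only equalities of hash values are needed, and the
  -- pattern records which hash function each one involves.
  refine ⟨t, x, p, Sum.elim id id v₀, h1, h2, h3, h4, fun a => ?_⟩
  have := congrArg (Sum.elim id id) (h5 a)
  rw [hval] at this
  refine this.trans ?_
  cases p.2 a with
  | none => rfl
  | some b => exact hval _ _

/-! ### Counting hash functions with prescribed values -/

lemma Fin.val_sum_eq_mod {ι : Type*} {m : ℕ} [NeZero m] (s : Finset ι) (v : ι → Fin m) :
    ((∑ j ∈ s, v j : Fin m) : ℕ) = (∑ j ∈ s, (v j : ℕ)) % m := by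
  classical
  induction s using Finset.induction_on with
  | empty => simp
  | insert a s ha ih => rw [Finset.sum_insert ha, Finset.sum_insert ha, Fin.val_add, ih]; simp

lemma HashSeq.hash_eq {U : Type*} {c d ℓ m : ℕ} [NeZero m] (h : HashSeq U c d ℓ m) (i : Fin d)
    (x : U) : h.hash i x = h.f i x + ∑ j, h.z i j (h.g j x) := by
  refine Fin.ext ?_
  rw [Fin.val_add, Fin.val_sum_eq_mod, Nat.add_mod_mod]
  rfl

section Counting

open scoped Classical

/-- Overwriting the prescribed cells of such a table by arbitrary values is injective into all
tables. -/
lemma card_filter_comp_eq_mul_le {I : Type*} [Fintype I] {ℓ m : ℕ} {γ : I → Fin ℓ}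
    (hγ : Function.Injective γ) (ρ : I → Fin m) :
    (Finset.univ.filter fun u : Fin ℓ → Fin m => ∀ i, u (γ i) = ρ i).card * m ^ Fintype.card I ≤
      m ^ ℓ := by
  have h1 : ((Finset.univ.filter fun u : Fin ℓ → Fin m => ∀ i, u (γ i) = ρ i) ×ˢ
      (Finset.univ : Finset (I → Fin m))).card ≤ (Finset.univ : Finset (Fin ℓ → Fin m)).card := by
    refine Finset.card_le_card_of_injOn (fun q => Function.extend γ q.2 q.1)
      (fun _ _ => Finset.mem_coe.2 (Finset.mem_univ _)) ?_
    rintro ⟨u, v⟩ hu ⟨u', v'⟩ hu' heq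
    have hu : ∀ i, u (γ i) = ρ i := by simpa using hu
    have hu' : ∀ i, u' (γ i) = ρ i := by simpa using hu'
    refine Prod.ext (funext fun b => ?_) (funext fun i => ?_)
    · by_cases hb : ∃ i, γ i = b
      · obtain ⟨i, rfl⟩ := hb
        exact (hu i).trans (hu' i).symm
      · have := congrFun heq b
        simpa only [Function.extend_apply' _ _ _ hb] using this
    · have := congrFun heq (γ i)
      simpa only [hγ.extend_apply] using this
  simpa [Finset.card_product] using h1

/-- The event splits into `m` disjoint cells according to the value `f y`, each of probability
`1/m²`. -/
lemma IsWiseIndependentClass.card_filter_sub_eq_mul_le {U : Type*} {m : ℕ} [NeZero m]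
    {H : Finset (U → Fin m)} (hH : IsWiseIndependentClass 2 H) {x y : U} (hxy : x ≠ y)
    (δ : Fin m) : (H.filter fun f => f x = δ + f y).card * m ≤ H.card := by
  have hm : (m : ℝ) ≠ 0 := NeZero.ne _
  rcases H.eq_empty_or_nonempty with rfl | hne
  · simp
  have hcell : ∀ b : Fin m, (H.filter fun f => f x = δ + b ∧ f y = b).card * m ^ 2 = H.card := by
    intro b
    have hinj : Function.Injective ![x, y] := by
      intro i i' h
      fin_cases i <;> fin_cases i' <;> simp_all [hxy.symm]
    have := hH ![x, y] hinj ![δ + b, b]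
    rw [unifProb, div_eq_div_iff (by exact_mod_cast hne.card_pos.ne') (by positivity)] at this
    simp only [Fin.forall_fin_two, Matrix.cons_val_zero, Matrix.cons_val_one, one_mul] at this
    exact_mod_cast this
  have hsum := Finset.card_eq_sum_card_fiberwise (s := H.filter fun f => f x = δ + f y)
    (t := Finset.univ) (f := fun f => f y) (fun _ _ => Finset.mem_coe.2 (Finset.mem_univ _))
  have hfib : ∀ b : Fin m, ((H.filter fun f => f x = δ + f y).filter fun f => f y = b) =
      H.filter fun f => f x = δ + b ∧ f y = b := by
    intro b
    ext f
    simp only [Finset.mem_filter]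
    constructor
    · rintro ⟨⟨h1, h2⟩, rfl⟩; exact ⟨h1, h2, rfl⟩
    · rintro ⟨h1, h2, rfl⟩; exact ⟨⟨h1, h2⟩, rfl⟩
  simp only [hfib] at hsum
  have htot : (H.filter fun f => f x = δ + f y).card * m ^ 2 = m * H.card := by
    rw [hsum, Finset.sum_mul, Finset.sum_congr rfl fun b _ => hcell b]
    simp
  have hmpos : 0 < m := NeZero.pos m
  nlinarith

/-- One table compensates for the lack of independence of `H` when there is at most one
collision. -/
lemma card_filter_add_eq_mul_le {U : Type*} {ℓ m t : ℕ} [NeZero m] {H : Finset (U → Fin m)}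
    (hH : IsWiseIndependentClass 2 H) {y : Fin t → U} (hy : Function.Injective y)
    {γ : Fin t → Fin ℓ} (hγ : t ≤ (Finset.univ.image γ).card + 1) (ρ : Fin t → Fin m) :
    ((H ×ˢ (Finset.univ : Finset (Fin ℓ → Fin m))).filter
      fun q => ∀ a, q.1 (y a) + q.2 (γ a) = ρ a).card * m ^ t ≤ H.card * m ^ ℓ := by
  by_cases hinj : Function.Injective γ
  -- Floor division is harmless here: a natural number whose product with `m ^ t` is at most `m ^ ℓ`
  -- is at most the floor.
  · have hle : ((H ×ˢ (Finset.univ : Finset (Fin ℓ → Fin m))).filter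
        fun q => ∀ a, q.1 (y a) + q.2 (γ a) = ρ a).card ≤ m ^ ℓ / m ^ t * H.card := by
      refine Finset.card_le_mul_card_image_of_maps_to (f := Prod.fst) (fun q hq => ?_) _ fun f _ => ?_
      · exact (Finset.mem_product.1 (Finset.mem_filter.1 hq).1).1
      · rw [Nat.le_div_iff_mul_le (pow_pos (NeZero.pos m) t)]
        refine le_trans (Nat.mul_le_mul_right _ ?_) ((congrArg _ (by rw [Fintype.card_fin])).trans_le
          (card_filter_comp_eq_mul_le hinj fun a => ρ a - f (y a)))
        refine Finset.card_le_card_of_injOn Prod.snd ?_ ?_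
        · rintro ⟨f', u⟩ hq
          simp only [Finset.coe_filter, Finset.mem_filter, Finset.mem_product, Set.mem_ofPred_eq] at hq ⊢
          obtain ⟨⟨-, h⟩, rfl⟩ := hq
          exact ⟨Finset.mem_univ _, fun a => eq_sub_of_add_eq' (h a)⟩
        · rintro ⟨f', u⟩ hq ⟨f'', u'⟩ hq' h
          exact Prod.ext ((Finset.mem_filter.1 hq).2.trans (Finset.mem_filter.1 hq').2.symm) h
    calc _ ≤ m ^ ℓ / m ^ t * H.card * m ^ t := Nat.mul_le_mul_right _ hle
      _ = H.card * (m ^ ℓ / m ^ t * m ^ t) := by ring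
      _ ≤ H.card * m ^ ℓ := Nat.mul_le_mul_left _ (Nat.div_mul_le_self _ _)
  · simp only [Function.Injective] at hinj
    push Not at hinj
    obtain ⟨a₀, b₀, hab, hne⟩ := hinj
    have ht : 0 < t := a₀.pos
    have himage : Finset.univ.image γ = (Finset.univ.erase a₀).image γ := by
      refine le_antisymm (fun v hv => ?_) (Finset.image_subset_image (Finset.erase_subset _ _))
      obtain ⟨a, -, rfl⟩ := Finset.mem_image.1 hv
      by_cases ha : a = a₀
      · subst ha
        exact Finset.mem_image.2 ⟨b₀, by simp [hne.symm], hab.symm⟩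
      · exact Finset.mem_image_of_mem _ (by simp [ha])
    have hinj' : Set.InjOn γ (Finset.univ.erase a₀ : Finset (Fin t)) := by
      rw [← Finset.card_image_iff]
      refine le_antisymm Finset.card_image_le ?_
      rw [← himage, Finset.card_erase_of_mem (Finset.mem_univ _), Finset.card_univ,
        Fintype.card_fin]
      omega
    have hsub : Function.Injective fun a : {a // a ≠ a₀} => γ a.1 := fun a b h =>
      Subtype.ext (hinj' (by simp [a.2]) (by simp [b.2]) h)
    have hcard : Fintype.card {a : Fin t // a ≠ a₀} = t - 1 := by simp
    -- Keys `a₀` and `b₀` read the same cell, so `f` alone must realise the difference of their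
    -- targets, which costs a factor `m`. The table supplies the other `t - 1` factors.
    have hle : ((H ×ˢ (Finset.univ : Finset (Fin ℓ → Fin m))).filter
        fun q => ∀ a, q.1 (y a) + q.2 (γ a) = ρ a).card ≤
          m ^ ℓ / m ^ (t - 1) *
            (H.filter fun f => f (y a₀) = (ρ a₀ - ρ b₀) + f (y b₀)).card := by
      refine Finset.card_le_mul_card_image_of_maps_to (f := Prod.fst) (fun q hq => ?_) _ fun f _ => ?_
      · obtain ⟨hq1, hq2⟩ := Finset.mem_filter.1 hq
        refine Finset.mem_filter.2 ⟨(Finset.mem_product.1 hq1).1, ?_⟩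
        rw [← hq2 a₀, ← hq2 b₀, hab]
        abel
      · rw [Nat.le_div_iff_mul_le (pow_pos (NeZero.pos m) _)]
        refine le_trans (Nat.mul_le_mul_right _ ?_) ((congrArg _ (by rw [hcard])).trans_le
          (card_filter_comp_eq_mul_le hsub fun a => ρ a - f (y a)))
        refine Finset.card_le_card_of_injOn Prod.snd ?_ ?_
        · rintro ⟨f', u⟩ hq
          simp only [Finset.coe_filter, Finset.mem_filter, Finset.mem_product, Set.mem_ofPred_eq] at hq ⊢
          obtain ⟨⟨-, h⟩, rfl⟩ := hq
          exact ⟨Finset.mem_univ _, fun a => eq_sub_of_add_eq' (h a)⟩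
        · rintro ⟨f', u⟩ hq ⟨f'', u'⟩ hq' h
          exact Prod.ext ((Finset.mem_filter.1 hq).2.trans (Finset.mem_filter.1 hq').2.symm) h
    have hm1 := hH.card_filter_sub_eq_mul_le (hy.ne hne) (ρ a₀ - ρ b₀)
    have hpow : m ^ t = m ^ (t - 1) * m := by rw [← pow_succ, Nat.sub_add_cancel ht]
    calc _ ≤ m ^ ℓ / m ^ (t - 1) *
            (H.filter fun f => f (y a₀) = (ρ a₀ - ρ b₀) + f (y b₀)).card * m ^ t :=
          Nat.mul_le_mul_right _ hle
      _ = (m ^ ℓ / m ^ (t - 1) * m ^ (t - 1)) *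
            ((H.filter fun f => f (y a₀) = (ρ a₀ - ρ b₀) + f (y b₀)).card * m) := by
          rw [hpow]; ring
      _ ≤ m ^ ℓ * H.card := Nat.mul_le_mul (Nat.div_mul_le_self _ _) hm1
      _ = H.card * m ^ ℓ := mul_comm _ _

/-- With every table except that of `j₀` fixed, their contribution is absorbed into the targets,
leaving the one-table case. -/
lemma card_filter_add_sum_eq_mul_le {U : Type*} {c ℓ m t : ℕ} [NeZero m] {H : Finset (U → Fin m)}
    (hH : IsWiseIndependentClass 2 H) {y : Fin t → U} (hy : Function.Injective y)
    {g : Fin c → U → Fin ℓ} (hg : ∃ j, t ≤ (Finset.univ.image (g j ∘ y)).card + 1)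
    (τ : Fin t → Fin m) :
    ((H ×ˢ (Finset.univ : Finset (Fin c → Fin ℓ → Fin m))).filter
      fun q => ∀ a, q.1 (y a) + ∑ j, q.2 j (g j (y a)) = τ a).card * m ^ t ≤
        H.card * (m ^ ℓ) ^ c := by
  obtain ⟨j₀, hj₀⟩ := hg
  have hle : ((H ×ˢ (Finset.univ : Finset (Fin c → Fin ℓ → Fin m))).filter
      fun q => ∀ a, q.1 (y a) + ∑ j, q.2 j (g j (y a)) = τ a).card ≤
        H.card * m ^ ℓ / m ^ t *
          (Finset.univ : Finset ({j : Fin c // j ≠ j₀} → Fin ℓ → Fin m)).card := by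
    refine Finset.card_le_mul_card_image_of_maps_to
      (f := fun q (j : {j : Fin c // j ≠ j₀}) => q.2 j) (fun q hq => Finset.mem_univ _) _
      fun v _ => ?_
    rw [Nat.le_div_iff_mul_le (pow_pos (NeZero.pos m) _)]
    refine le_trans (Nat.mul_le_mul_right _ ?_)
      (card_filter_add_eq_mul_le hH hy hj₀
        fun a => τ a - ∑ j : {j : Fin c // j ≠ j₀}, v j (g j (y a)))
    refine Finset.card_le_card_of_injOn (fun q => (q.1, q.2 j₀)) ?_ ?_
    · rintro ⟨f, z⟩ hq
      simp only [Finset.coe_filter, Finset.mem_filter, Finset.mem_product, Set.mem_ofPred_eq] at hq ⊢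
      obtain ⟨⟨⟨hf, -⟩, h⟩, rfl⟩ := hq
      refine ⟨⟨hf, Finset.mem_univ _⟩, fun a => eq_sub_of_add_eq ?_⟩
      rw [← h a, add_assoc, Function.comp_apply]
      congr 1
      rw [← Finset.add_sum_erase _ _ (Finset.mem_univ j₀)]
      congr 1
      exact (Finset.sum_subtype _ (fun j => by simp) fun j => z j (g j (y a))).symm
    · rintro ⟨f, z⟩ hq ⟨f', z'⟩ hq' h
      obtain ⟨h1, h2⟩ := Prod.ext_iff.1 h
      refine Prod.ext h1 (funext fun j => ?_)
      by_cases hj : j = j₀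
      · rw [hj]; exact h2
      · exact congrFun ((Finset.mem_filter.1 hq).2.trans (Finset.mem_filter.1 hq').2.symm) ⟨j, hj⟩
  have hc : 0 < c := j₀.pos
  have hcard : (Finset.univ : Finset ({j : Fin c // j ≠ j₀} → Fin ℓ → Fin m)).card =
      (m ^ ℓ) ^ (c - 1) := by simp
  rw [hcard] at hle
  calc _ ≤ H.card * m ^ ℓ / m ^ t * (m ^ ℓ) ^ (c - 1) * m ^ t := Nat.mul_le_mul_right _ hle
    _ = (H.card * m ^ ℓ / m ^ t * m ^ t) * (m ^ ℓ) ^ (c - 1) := by ring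
    _ ≤ H.card * m ^ ℓ * (m ^ ℓ) ^ (c - 1) := Nat.mul_le_mul_right _ (Nat.div_mul_le_self _ _)
    _ = H.card * (m ^ ℓ) ^ c := by
      rw [mul_assoc, ← pow_succ', Nat.sub_add_cancel hc]

/-- For `g` of deficiency at most one, the pair of hash functions is uniform on the given keys. -/
lemma card_filter_hash_eq_mul_le {U : Type*} {c ℓ m t : ℕ} [NeZero m] {H : Finset (U → Fin m)}
    (hH : IsWiseIndependentClass 2 H) {y : Fin t → U} (hy : Function.Injective y)
    {g : Fin c → U → Fin ℓ} (hg : ∃ j, t ≤ (Finset.univ.image (g j ∘ y)).card + 1)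
    (τ : Fin 2 → Fin t → Fin m) :
    (((Fintype.piFinset fun _ : Fin 2 => H) ×ˢ
      (Finset.univ : Finset (Fin 2 → Fin c → Fin ℓ → Fin m))).filter
        fun q => ∀ i a, (HashSeq.mk q.1 g q.2).hash i (y a) = τ i a).card * (m ^ t) ^ 2 ≤
      (H.card * (m ^ ℓ) ^ c) ^ 2 := by
  let Q : Fin 2 → Finset ((U → Fin m) × (Fin c → Fin ℓ → Fin m)) := fun i =>
    (H ×ˢ (Finset.univ : Finset (Fin c → Fin ℓ → Fin m))).filter
      fun q => ∀ a, q.1 (y a) + ∑ j, q.2 j (g j (y a)) = τ i a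
  have hle : (((Fintype.piFinset fun _ : Fin 2 => H) ×ˢ
      (Finset.univ : Finset (Fin 2 → Fin c → Fin ℓ → Fin m))).filter
        fun q => ∀ i a, (HashSeq.mk q.1 g q.2).hash i (y a) = τ i a).card ≤
      (Fintype.piFinset Q).card := by
    refine Finset.card_le_card_of_injOn (fun q i => (q.1 i, q.2 i)) ?_ ?_
    · rintro ⟨f, z⟩ hq
      obtain ⟨hq1, hq2⟩ := Finset.mem_filter.1 hq
      refine Finset.mem_coe.2 (Fintype.mem_piFinset.2 fun i => Finset.mem_filter.2 ⟨?_, fun a => ?_⟩)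
      · exact Finset.mem_product.2
          ⟨Fintype.mem_piFinset.1 (Finset.mem_product.1 hq1).1 i, Finset.mem_univ _⟩
      · rw [← hq2 i a, HashSeq.hash_eq]
    · rintro ⟨f, z⟩ _ ⟨f', z'⟩ _ h
      exact Prod.ext (funext fun i => congrArg Prod.fst (congrFun h i))
        (funext fun i => congrArg Prod.snd (congrFun h i))
  rw [Fintype.card_piFinset, Fin.prod_univ_two] at hle
  have hQ := fun i => card_filter_add_sum_eq_mul_le hH hy hg (τ i)
  calc _ ≤ (Q 0).card * (Q 1).card * (m ^ t) ^ 2 := Nat.mul_le_mul_right _ hle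
    _ = ((Q 0).card * m ^ t) * ((Q 1).card * m ^ t) := by ring
    _ ≤ (H.card * (m ^ ℓ) ^ c) * (H.card * (m ^ ℓ) ^ c) := Nat.mul_le_mul (hQ 0) (hQ 1)
    _ = _ := (sq _).symm

/-- The values at the starting points determine all others, so at most `m^t` assignments fit the
pattern, each of probability at most `m^(-2t)`. -/
lemma card_filter_pattern_mul_le {U : Type*} {c ℓ m t : ℕ} [NeZero m] {H : Finset (U → Fin m)}
    (hH : IsWiseIndependentClass 2 H) {y : Fin t → U} (hy : Function.Injective y)
    {g : Fin c → U → Fin ℓ} (hg : ∃ j, t ≤ (Finset.univ.image (g j ∘ y)).card + 1)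
    (p : (Fin t → Fin 2) × (Fin t → Option (Fin t))) (w : Fin m) :
    (((Fintype.piFinset fun _ : Fin 2 => H) ×ˢ
      (Finset.univ : Finset (Fin 2 → Fin c → Fin ℓ → Fin m))).filter
        fun q => ∀ a, (HashSeq.mk q.1 g q.2).hash (p.1 a + 1) (y a) =
          (p.2 a).elim w fun b => (HashSeq.mk q.1 g q.2).hash (p.1 b) (y b)).card * m ^ t ≤
      (H.card * (m ^ ℓ) ^ c) ^ 2 := by
  let T : Finset (Fin 2 → Fin t → Fin m) := Finset.univ.filter fun τ =>
    ∀ a, τ (p.1 a + 1) a = (p.2 a).elim w fun b => τ (p.1 b) b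
  have hT : T.card ≤ m ^ t := by
    have : T.card ≤ (Finset.univ : Finset (Fin t → Fin m)).card := by
      refine Finset.card_le_card_of_injOn (fun τ a => τ (p.1 a) a)
        (fun _ _ => Finset.mem_coe.2 (Finset.mem_univ _)) ?_
      intro τ hτ τ' hτ' h
      have hτ := (Finset.mem_filter.1 hτ).2
      have hτ' := (Finset.mem_filter.1 hτ').2
      have h0 : ∀ a, τ (p.1 a) a = τ' (p.1 a) a := congrFun h
      refine funext fun s => funext fun a => ?_
      rcases fin_two_eq_or_eq_add_one (p.1 a) s with rfl | rfl
      · exact h0 a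
      · rw [hτ a, hτ' a]
        cases p.2 a with
        | none => rfl
        | some b => exact h0 b
    simpa using this
  have hle := Finset.card_le_mul_card_image_of_maps_to (s := ((Fintype.piFinset fun _ : Fin 2 => H) ×ˢ
      (Finset.univ : Finset (Fin 2 → Fin c → Fin ℓ → Fin m))).filter
        fun q => ∀ a, (HashSeq.mk q.1 g q.2).hash (p.1 a + 1) (y a) =
          (p.2 a).elim w fun b => (HashSeq.mk q.1 g q.2).hash (p.1 b) (y b)) (t := T)
      (f := fun q i a => (HashSeq.mk q.1 g q.2).hash i (y a))
      (fun q hq => Finset.mem_filter.2 ⟨Finset.mem_univ _, (Finset.mem_filter.1 hq).2⟩)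
      ((H.card * (m ^ ℓ) ^ c) ^ 2 / (m ^ t) ^ 2) (by
        intro τ _
        rw [Nat.le_div_iff_mul_le (pow_pos (pow_pos (NeZero.pos m) _) _)]
        refine le_trans (Nat.mul_le_mul_right _ (Finset.card_le_card fun q hq => ?_))
          (card_filter_hash_eq_mul_le hH hy hg τ)
        obtain ⟨hq1, hq2⟩ := Finset.mem_filter.1 hq
        exact Finset.mem_filter.2 ⟨(Finset.mem_filter.1 hq1).1,
          fun i a => congrFun (congrFun hq2 i) a⟩)
  calc _ ≤ (H.card * (m ^ ℓ) ^ c) ^ 2 / (m ^ t) ^ 2 * T.card * m ^ t := Nat.mul_le_mul_right _ hle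
    _ ≤ (H.card * (m ^ ℓ) ^ c) ^ 2 / (m ^ t) ^ 2 * m ^ t * m ^ t :=
      Nat.mul_le_mul_right _ (Nat.mul_le_mul_left _ hT)
    _ = (H.card * (m ^ ℓ) ^ c) ^ 2 / (m ^ t) ^ 2 * (m ^ t) ^ 2 := by ring
    _ ≤ _ := Nat.div_mul_le_self _ _

end Counting

/-! ### Probability bounds -/

section Probability

open scoped Classical

lemma unifProb_mono {α : Type*} (A : Finset α) {P Q : α → Prop} (h : ∀ a ∈ A, P a → Q a) :
    unifProb A P ≤ unifProb A Q := by
  unfold unifProb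
  gcongr 1
  exact_mod_cast Finset.card_le_card fun a ha =>
    Finset.mem_filter.2 ⟨(Finset.mem_filter.1 ha).1,
      h a (Finset.mem_filter.1 ha).1 (Finset.mem_filter.1 ha).2⟩

/-- The union bound. -/
lemma unifProb_le_sum {α ι : Type*} (A : Finset α) (I : Finset ι) {P : α → Prop}
    {Q : ι → α → Prop} (h : ∀ a ∈ A, P a → ∃ i ∈ I, Q i a) :
    unifProb A P ≤ ∑ i ∈ I, unifProb A (Q i) := by
  unfold unifProb
  rw [← Finset.sum_div]
  gcongr 1
  have hsub : A.filter P ⊆ I.biUnion fun i => A.filter (Q i) := by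
    intro a ha
    obtain ⟨haA, haP⟩ := Finset.mem_filter.1 ha
    obtain ⟨i, hi, hQ⟩ := h a haA haP
    exact Finset.mem_biUnion.2 ⟨i, hi, Finset.mem_filter.2 ⟨haA, hQ⟩⟩
  exact_mod_cast (Finset.card_le_card hsub).trans Finset.card_biUnion_le

lemma IsUniversalClass.card_not_injective_le {U : Type*} {ℓ t : ℕ} {b : ℝ} (hb : 0 ≤ b)
    {F : Finset (U → Fin ℓ)} (hF : IsUniversalClass b F) (hne : F.Nonempty) {y : Fin t → U}
    (hy : Function.Injective y) :
    ((F.filter fun g => ¬ Function.Injective (g ∘ y)).card : ℝ) ≤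
      b * (t : ℝ) ^ 2 / ℓ * F.card := by
  have hpos : (0 : ℝ) < F.card := by exact_mod_cast hne.card_pos
  have hunion : unifProb F (fun g => ¬ Function.Injective (g ∘ y)) ≤
      ∑ q ∈ (Finset.univ : Finset (Fin t × Fin t)).filter (fun q => q.1 ≠ q.2),
        unifProb F (fun g => g (y q.1) = g (y q.2)) := by
    refine unifProb_le_sum F _ fun g _ hg => ?_
    simp only [Function.Injective] at hg
    push Not at hg
    obtain ⟨a, a', h, hne⟩ := hg
    exact ⟨(a, a'), by simp [hne], h⟩
  have hsum : ∑ q ∈ (Finset.univ : Finset (Fin t × Fin t)).filter (fun q => q.1 ≠ q.2),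
      unifProb F (fun g => g (y q.1) = g (y q.2)) ≤ (t : ℝ) ^ 2 * (b / ℓ) := by
    refine (Finset.sum_le_card_nsmul _ _ (b / ℓ) fun q hq =>
      hF _ _ (hy.ne (Finset.mem_filter.1 hq).2)).trans ?_
    rw [nsmul_eq_mul]
    gcongr
    have : ((Finset.univ : Finset (Fin t × Fin t)).filter (fun q => q.1 ≠ q.2)).card ≤ t ^ 2 :=
      (Finset.card_filter_le _ _).trans (by simp [sq])
    exact_mod_cast this
  have := hunion.trans hsum
  rw [unifProb, div_le_iff₀ hpos] at this
  have heq : (t : ℝ) ^ 2 * (b / ℓ) * F.card = b * (t : ℝ) ^ 2 / ℓ * F.card := by ring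
  rw [heq] at this
  refine le_trans (le_of_eq ?_) this
  congr!

lemma card_hashClassZ {U : Type*} {ℓ m : ℕ} (c d : ℕ) (F : Finset (U → Fin ℓ))
    (H : Finset (U → Fin m)) :
    (hashClassZ c d F H).card = F.card ^ c * (H.card * (m ^ ℓ) ^ c) ^ d := by
  rw [hashClassZ, Finset.card_map, Finset.card_product, Finset.card_product,
    Fintype.card_piFinset_const, Fintype.card_piFinset_const, Finset.card_univ]
  simp only [Fintype.card_fun, Fintype.card_fin]
  ring

lemma mem_hashClassZ {U : Type*} {ℓ m c d : ℕ} {F : Finset (U → Fin ℓ)} {H : Finset (U → Fin m)}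
    {h : HashSeq U c d ℓ m} :
    h ∈ hashClassZ c d F H ↔ (∀ i, h.f i ∈ H) ∧ ∀ j, h.g j ∈ F := by
  rw [hashClassZ, Finset.mem_map_equiv]
  simp [HashSeq.ofTriple, Fintype.mem_piFinset]

/-- Condition on `g`: each component must collide on the keys, and a `g` of deficiency above one has
an empty fibre. -/
lemma card_criticalTrail_mul_le {U : Type*} {c ℓ m t : ℕ} [NeZero m] {F : Finset (U → Fin ℓ)}
    {H : Finset (U → Fin m)} (hH : IsWiseIndependentClass 2 H) {y : Fin t → U}
    (hy : Function.Injective y) (p : (Fin t → Fin 2) × (Fin t → Option (Fin t))) (w : Fin m) :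
    ((hashClassZ c 2 F H).filter (CriticalTrail y p w)).card * m ^ t ≤
      (H.card * (m ^ ℓ) ^ c) ^ 2 *
        (F.filter fun g => ¬ Function.Injective (g ∘ y)).card ^ c := by
  let N := (F.filter fun g => ¬ Function.Injective (g ∘ y)).card
  have hle := Finset.card_le_mul_card_image_of_maps_to
    (s := (hashClassZ c 2 F H).filter (CriticalTrail y p w))
    (t := Fintype.piFinset fun _ : Fin c => F.filter fun g => ¬ Function.Injective (g ∘ y))
    (f := HashSeq.g) (fun h hh => by
      obtain ⟨h1, h2⟩ := Finset.mem_filter.1 hh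
      exact Fintype.mem_piFinset.2 fun j =>
        Finset.mem_filter.2 ⟨(mem_hashClassZ.1 h1).2 j, h2.1 j⟩)
    ((H.card * (m ^ ℓ) ^ c) ^ 2 / m ^ t) (by
      intro g _
      rw [Nat.le_div_iff_mul_le (pow_pos (NeZero.pos m) _)]
      by_cases hg : ∃ j, t ≤ (Finset.univ.image (g j ∘ y)).card + 1
      · refine le_trans (Nat.mul_le_mul_right _ ?_) (card_filter_pattern_mul_le hH hy hg p w)
        refine Finset.card_le_card_of_injOn (fun h => (h.f, h.z)) ?_ ?_
        · rintro ⟨f, g', z⟩ hh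
          obtain ⟨hh1, rfl⟩ := Finset.mem_filter.1 hh
          obtain ⟨h1, h2⟩ := Finset.mem_filter.1 hh1
          exact Finset.mem_coe.2 (Finset.mem_filter.2 ⟨Finset.mem_product.2
            ⟨Fintype.mem_piFinset.2 (mem_hashClassZ.1 h1).1, Finset.mem_univ _⟩, h2.2.2⟩)
        · rintro ⟨f, g₁, z⟩ hh ⟨f', g₂, z'⟩ hh' heq
          obtain ⟨-, rfl⟩ := Finset.mem_filter.1 hh
          obtain ⟨-, hg'⟩ := Finset.mem_filter.1 hh'
          obtain ⟨h1, h2⟩ := Prod.ext_iff.1 heq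
          simp only at h1 h2 hg'
          rw [h1, h2, hg']
      · rw [Finset.card_eq_zero.2, zero_mul]
        · exact Nat.zero_le _
        · refine Finset.filter_eq_empty_iff.2 fun h hh hgeq => hg ?_
          rw [← hgeq]
          exact (Finset.mem_filter.1 hh).2.2.1)
  rw [Fintype.card_piFinset_const] at hle
  calc _ ≤ (H.card * (m ^ ℓ) ^ c) ^ 2 / m ^ t * N ^ c * m ^ t := Nat.mul_le_mul_right _ hle
    _ = (H.card * (m ^ ℓ) ^ c) ^ 2 / m ^ t * m ^ t * N ^ c := by ring
    _ ≤ _ := Nat.mul_le_mul_right _ (Nat.div_mul_le_self _ _)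

lemma unifProb_criticalTrail_le {U : Type*} {c ℓ m t : ℕ} [NeZero m] {b : ℝ} (hb : 0 ≤ b)
    {F : Finset (U → Fin ℓ)} {H : Finset (U → Fin m)} (hFne : F.Nonempty) (hHne : H.Nonempty)
    (hF : IsUniversalClass b F) (hH : IsWiseIndependentClass 2 H) {y : Fin t → U}
    (hy : Function.Injective y) (p : (Fin t → Fin 2) × (Fin t → Option (Fin t))) (w : Fin m) :
    unifProb (hashClassZ c 2 F H) (CriticalTrail y p w) ≤ (b * (t : ℝ) ^ 2 / ℓ) ^ c / m ^ t := by
  have hm : (0 : ℝ) < m := by exact_mod_cast NeZero.pos m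
  have hFpos : (0 : ℝ) < F.card := by exact_mod_cast hFne.card_pos
  have hHpos : (0 : ℝ) < H.card := by exact_mod_cast hHne.card_pos
  have h1 : (((hashClassZ c 2 F H).filter (CriticalTrail y p w)).card : ℝ) * (m : ℝ) ^ t ≤
      ((H.card : ℝ) * ((m : ℝ) ^ ℓ) ^ c) ^ 2 *
        ((F.filter fun g => ¬ Function.Injective (g ∘ y)).card : ℝ) ^ c := by
    exact_mod_cast card_criticalTrail_mul_le (F := F) (c := c) hH hy p w
  have h2 := hF.card_not_injective_le hb hFne hy
  rw [unifProb, card_hashClassZ]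
  push_cast
  rw [div_le_div_iff₀ (by positivity) (by positivity)]
  refine h1.trans ?_
  calc _ ≤ ((H.card : ℝ) * ((m : ℝ) ^ ℓ) ^ c) ^ 2 * (b * (t : ℝ) ^ 2 / ℓ * F.card) ^ c := by
        gcongr
    _ = _ := by rw [mul_pow]; ring

lemma unifProb_failureEvent_LC_le {U : Type*} [LinearOrder U] {c ℓ m n : ℕ} [NeZero m]
    (hc : 1 ≤ c) {b : ℝ} (hb : 0 ≤ b) {F : Finset (U → Fin ℓ)} {H : Finset (U → Fin m)}
    (hFne : F.Nonempty) (hHne : H.Nonempty) (hF : IsUniversalClass b F)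
    (hH : IsWiseIndependentClass 2 H) (S : Finset U) (hS : S.card = n) :
    unifProb (hashClassZ c 2 F H) (FailureEvent S hS (BiGraph.LC m n)) ≤
      ∑ t ∈ Finset.Icc 1 n, (n : ℝ) ^ t * (2 * (t * ((t + 1) * 2)) ^ (2 * c)) * m *
        ((b * (t : ℝ) ^ 2 / ℓ) ^ c / m ^ t) := by
  let I : (t : ℕ) → Finset ((Fin t → Fin n) × ((Fin t → Fin 2) × (Fin t → Option (Fin t))) × Fin m) :=
    fun t => (Finset.univ.filter Function.Injective) ×ˢ
      ((Finset.univ.filter (IsTrailPattern t (2 * c))) ×ˢ Finset.univ)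
  refine (unifProb_le_sum _ (Finset.Icc 1 n) (Q := fun t h => ∃ q ∈ I t,
    CriticalTrail (S.orderEmbOfFin hS ∘ q.1) q.2.1 q.2.2 h) fun h _ hfail => ?_).trans
      (Finset.sum_le_sum fun t ht => ?_)
  · obtain ⟨t, x, p, w, hx, hp, hcrit⟩ := exists_criticalTrail_of_failureEvent hc hfail
    refine ⟨t, Finset.mem_Icc.2 ⟨?_, by simpa using Fintype.card_le_of_injective x hx⟩,
      (x, p, w), by simp [I, hx, hp], hcrit⟩
    -- Without keys there is no collision, and `c ≥ 1` demands one.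
    rw [Nat.one_le_iff_ne_zero]
    rintro rfl
    exact hcrit.1 ⟨0, hc⟩ (Function.injective_of_subsingleton _)
  · refine (unifProb_le_sum _ (I t) fun h _ hq => hq).trans ?_
    refine (Finset.sum_le_card_nsmul _ _ ((b * (t : ℝ) ^ 2 / ℓ) ^ c / m ^ t) fun q hq => ?_).trans ?_
    · exact unifProb_criticalTrail_le hb hFne hHne hF hH ((S.orderEmbOfFin hS).injective.comp
        (Finset.mem_filter.1 (Finset.mem_product.1 hq).1).2) _ _
    · rw [nsmul_eq_mul]
      gcongr
      have hcard : (I t).card ≤ n ^ t * ((2 * (t * ((t + 1) * 2)) ^ (2 * c)) * m) := by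
        simp only [I, Finset.card_product]
        refine Nat.mul_le_mul ((Finset.card_filter_le _ _).trans (by simp))
          (Nat.mul_le_mul (card_isTrailPattern_le (Finset.mem_Icc.1 ht).1 _) (by simp))
      rw [mul_assoc]
      exact_mod_cast hcard

/-- The summands of the union bound decay geometrically, up to a polynomial factor. -/
lemma trail_summand_le {ε : ℝ} (hε : 0 < ε) {c n m ℓ t : ℕ} (ht : 1 ≤ t) (hm : 0 < m)
    (hnm : (1 + ε) * (n : ℝ) ≤ (m : ℝ)) :
    (n : ℝ) ^ t * (2 * (t * ((t + 1) * 2)) ^ (2 * c)) * m * ((2 * (t : ℝ) ^ 2 / ℓ) ^ c / m ^ t) ≤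
      (2 * 4 ^ (2 * c) * 2 ^ c * (1 + ε)) * ((t : ℝ) ^ (6 * c) * ((1 + ε)⁻¹) ^ t) *
        ((n : ℝ) / (ℓ : ℝ) ^ c) := by
  -- The factor `m` for the root cancels one factor of `m ^ t`, leaving `n * (n / m) ^ s` with `s =
  -- t - 1`.
  obtain ⟨s, rfl⟩ := Nat.exists_eq_add_of_le' ht
  set T : ℝ := ((s + 1 : ℕ) : ℝ) with hT
  have hT1 : 1 ≤ T := by rw [hT]; exact_mod_cast ht
  have hm' : (0 : ℝ) < m := by exact_mod_cast hm
  have hε1 : 0 < 1 + ε := by linarith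
  have hratio : (n : ℝ) / m ≤ (1 + ε)⁻¹ := by
    rw [div_le_iff₀ hm', inv_mul_eq_div, le_div_iff₀ hε1]
    linarith
  have hpoly : (T * ((T + 1) * 2)) ^ (2 * c) ≤ (4 * T ^ 2) ^ (2 * c) := by
    refine pow_le_pow_left₀ (by positivity) ?_ _
    nlinarith
  calc _ = 2 * (T * ((T + 1) * 2)) ^ (2 * c) * (2 * T ^ 2) ^ c * ((n : ℝ) / m) ^ s *
        ((n : ℝ) / (ℓ : ℝ) ^ c) := by
        rw [div_pow, div_pow, pow_succ (n : ℝ), pow_succ (m : ℝ)]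
        field_simp
    _ ≤ 2 * (4 * T ^ 2) ^ (2 * c) * (2 * T ^ 2) ^ c * ((1 + ε)⁻¹) ^ s *
        ((n : ℝ) / (ℓ : ℝ) ^ c) := by gcongr
    _ = _ := by
        -- The exponent is `4c` from the pattern count plus `2c` from the collision bound.
        have h6 : T ^ (6 * c) = (T ^ 2) ^ (2 * c) * (T ^ 2) ^ c := by
          rw [← pow_mul, ← pow_mul, ← pow_add]; congr 1; ring
        have hs : ((1 + ε)⁻¹) ^ s = (1 + ε) * ((1 + ε)⁻¹) ^ (s + 1) := by
          rw [pow_succ', mul_inv_cancel_left₀ hε1.ne']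
        rw [mul_pow 4, mul_pow 2, h6, hs]
        ring

end Probability

theorem mainTheorem4 (ε : ℝ) (hε : 0 < ε) (c : ℕ) (hc : 1 ≤ c) :
    ∃ K : ℝ, 0 < K ∧
      ∀ (U : Type*) [Fintype U] [LinearOrder U] (n m ℓ : ℕ), 1 ≤ ℓ → (1 + ε) * (n : ℝ) ≤ (m : ℝ) →
      ∀ (F : Finset (U → Fin ℓ)) (H : Finset (U → Fin m)), F.Nonempty → H.Nonempty →
        IsUniversalClass 2 F → IsWiseIndependentClass 2 H →
      ∀ (S : Finset U) (hS : S.card = n),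
        unifProb (hashClassZ c 2 F H) (FailureEvent S hS (BiGraph.LL m n)) ≤
            unifProb (hashClassZ c 2 F H) (FailureEvent S hS (BiGraph.LC m n)) ∧
          unifProb (hashClassZ c 2 F H) (FailureEvent S hS (BiGraph.LC m n)) ≤
            K * ((n : ℝ) / (ℓ : ℝ) ^ c) := by
  have hq : ‖(1 + ε)⁻¹‖ < 1 := by
    rw [Real.norm_of_nonneg (by positivity)]
    exact inv_lt_one_of_one_lt₀ (by linarith)
  have hsum : Summable fun t : ℕ => (t : ℝ) ^ (6 * c) * ((1 + ε)⁻¹) ^ t :=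
    summable_pow_mul_geometric_of_norm_lt_one _ hq
  let A : ℝ := 2 * 4 ^ (2 * c) * 2 ^ c * (1 + ε)
  have hA : 0 < A := by positivity
  let B : ℝ := ∑' t : ℕ, (t : ℝ) ^ (6 * c) * ((1 + ε)⁻¹) ^ t
  have hB : 0 ≤ B := tsum_nonneg fun t => by positivity
  refine ⟨A * (B + 1), by positivity, ?_⟩
  intro U _ _ n m ℓ hℓ hnm F H hFne hHne hF hH S hS
  refine ⟨unifProb_mono _ fun h _ ⟨G, hG, hrest⟩ => ⟨G, BiGraph.LL_subset_LC hG, hrest⟩, ?_⟩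
  -- For `m = 0` also `n = 0`, and failure is impossible because it would yield a root value in `Fin
  -- 0`.
  rcases Nat.eq_zero_or_pos m with rfl | hm
  · have hn : n = 0 := by
      have : (n : ℝ) ≤ 0 := by
        push_cast at hnm
        nlinarith [(Nat.cast_nonneg n : (0 : ℝ) ≤ n)]
      exact_mod_cast le_antisymm this (Nat.cast_nonneg n)
    subst hn
    refine (unifProb_le_sum _ (∅ : Finset Unit) (Q := fun _ _ => False) fun h _ hfail => ?_).trans
      (by simp)
    obtain ⟨_, _, _, w, _⟩ := exists_criticalTrail_of_failureEvent hc hfail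
    exact w.elim0
  · have : NeZero m := ⟨hm.ne'⟩
    refine (unifProb_failureEvent_LC_le hc zero_le_two hFne hHne hF hH S hS).trans ?_
    refine (Finset.sum_le_sum fun t ht =>
      trail_summand_le hε (Finset.mem_Icc.1 ht).1 hm hnm).trans ?_
    rw [← Finset.sum_mul, ← Finset.mul_sum]
    have hle : ∑ t ∈ Finset.Icc 1 n, (t : ℝ) ^ (6 * c) * ((1 + ε)⁻¹) ^ t ≤ B :=
      hsum.sum_le_tsum _ fun t _ => by positivity
    have : ∑ t ∈ Finset.Icc 1 n, (t : ℝ) ^ (6 * c) * ((1 + ε)⁻¹) ^ t ≤ B + 1 := by linarith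
    change A * _ * _ ≤ A * _ * _
    gcongr
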